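/- **Conventions.** Let $\delta>0$, and use the Fourier transform $\hat f(\xi)=\int_{\mathbb R}e^{-2\pi i x\xi}f(x)\,dx$ (extended to tempered distributions). Let $$\mathcal T_\delta f(x)=-\frac1{2\delta}\,\mathrm{p.v.}\!\int\coth\Big(\frac{\pi(x-y)}{2\delta}\Big)f(y)\,dy ,$$ understood in the sense that $\partial_x\mathcal T_\delta$ is the Fourier multiplier with symbol $-2\pi\xi\coth(2\pi\delta\xi)$ (equal to $-1/\delta$ at $\xi=0$), and $\mathcal T_\delta\partial_x^2=\partial_x(\partial_x\mathcal T_\delta)$. The intermediate long wave (ILW) equation is $$\partial_t u+\mathcal T_\delta\partial_x^2u+\frac1\delta\,\partial_xu+u\,\partial_xu=0,\qquad (t,x)\in\mathbb R\times\mathbb R,$$ for a real-valued function $u=u(t,x)$, with $u\,\partial_xu=\tfrac12\partial_x(u^2)$. A solution is a family $u(t)\in L^2(\mathbb R)$, $t\in\mathbb R$, such that, for every Schwartz function $\varphi$, the function $t\mapsto\langle u(t),\varphi\rangle$ is differentiable on $\mathbb R$ with derivative $-\langle \mathcal T_\delta\partial_x^2u(t)+\tfrac1\delta\partial_xu(t)+\tfrac12\partial_x(u(t)^2),\varphi\rangle$.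 **Theorem 1.6.** Let $s>1/2$ and let $u$ be a solution of the ILW equation with $$u\in C(\mathbb R;H^s(\mathbb R))\cap L^\infty(\mathbb R;H^s(\mathbb R)).$$ Let $\epsilon>0$ and let $\mu:\mathbb R\to\mathbb R$ be a function for which there is a constant $c>0$ with $\mu(t)\ge c\,t\log^{1+\epsilon}t$ for all sufficiently large $t$. Then, for all constants $0<a\le b$, $$\lim_{t\to+\infty}\|u(t)\|_{L^2(\{x\in\mathbb R:\ a\,\mu(t)\le|x|\le b\,\mu(t)\})}=0 .$$ -/

import Mathlib

open MeasureTheory Filter Topology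
open scoped SchwartzMap ENNReal

namespace ILW

noncomputable section

/-! ### The dispersive operator -/

/-- The hyperbolic cotangent (used at nonzero points only). -/
def coth (x : ℝ) : ℝ := Real.cosh x / Real.sinh x

/-- The symbol `-2πξ coth(2πδξ)` of `∂ₓ 𝒯_δ`, extended continuously to `ξ = 0`
by its limit `-1/δ`. -/
def symbolDT (δ ξ : ℝ) : ℝ :=
  if ξ = 0 then -(1 / δ) else -(2 * Real.pi * ξ) * coth (2 * Real.pi * δ * ξ)

/-- The operator `∂ₓ 𝒯_δ` on tempered distributions: the Fourier multiplier with symbol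
`-2πξ coth(2πδξ)`, for the Fourier transform `f̂(ξ) = ∫ e^{-2πixξ} f(x) dx`.
The symbol has temperate growth by `hasTemperateGrowth_symbolDT` below. -/
def opDT (δ : ℝ) : 𝓢'(ℝ, ℂ) →L[ℂ] 𝓢'(ℝ, ℂ) :=
  TemperedDistribution.fourierMultiplierCLM ℂ (fun ξ : ℝ => ((symbolDT δ ξ : ℝ) : ℂ))

/-! ### Solutions -/

/-- A real-valued `L^p` function, regarded as a (complex-valued) tempered distribution. -/
def toDist {p : ℝ≥0∞} [Fact (1 ≤ p)] (f : Lp ℝ p (volume : Measure ℝ)) : 𝓢'(ℝ, ℂ) :=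
  Lp.toTemperedDistribution (Complex.ofRealCLM.compLp f)

/-- The square of a real-valued `L²` function, an element of `L¹`. -/
def sqL1 (f : Lp ℝ 2 (volume : Measure ℝ)) : Lp ℝ 1 (volume : Measure ℝ) := f • f

/-- The tempered distribution `𝒯_δ ∂ₓ² f + δ⁻¹ ∂ₓ f + f ∂ₓ f`, with `f ∂ₓ f = ∂ₓ (f² / 2)`. -/
def spatialPart (δ : ℝ) (f : Lp ℝ 2 (volume : Measure ℝ)) : 𝓢'(ℝ, ℂ) :=
  TemperedDistribution.derivCLM ℂ (opDT δ (toDist f))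
    + ((1 / δ : ℝ) : ℂ) • TemperedDistribution.derivCLM ℂ (toDist f)
    + (1 / 2 : ℂ) • TemperedDistribution.derivCLM ℂ (toDist (sqL1 f))

/-- `u` solves `∂ₜ u + 𝒯_δ ∂ₓ² u + δ⁻¹ ∂ₓ u + u ∂ₓ u = 0` on `ℝ × ℝ` in the sense of
distributions: at every time the equation holds after pairing with any Schwartz function
of `x`. -/
def IsSolution (δ : ℝ) (u : ℝ → Lp ℝ 2 (volume : Measure ℝ)) : Prop :=
  ∀ (φ : 𝓢(ℝ, ℂ)) (t : ℝ),
    HasDerivAt (fun τ : ℝ => toDist (u τ) φ) (-(spatialPart δ (u t) φ)) t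

/-- `u ∈ C(ℝ; H^s(ℝ)) ∩ L^∞(ℝ; H^s(ℝ))`. As `f ↦ ⟨D⟩^s f` (the Bessel potential of order `s`) is
an isometry of `H^s` onto `L²`, this says that `t ↦ ⟨D⟩^s u(t)` is a bounded continuous
function with values in `L²`. -/
def BoundedContinuousSobolev (s : ℝ) (u : ℝ → Lp ℝ 2 (volume : Measure ℝ)) : Prop :=
  ∃ v : ℝ → Lp ℂ 2 (volume : Measure ℝ),
    (∀ t, TemperedDistribution.besselPotential ℝ ℂ s (toDist (u t))
      = Lp.toTemperedDistribution (v t)) ∧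
    Continuous v ∧ ∃ C : ℝ, ∀ t, ‖v t‖ ≤ C

/-! ### The symbol is of temperate growth -/

theorem contDiff_dslope_sinh : ContDiff ℝ (⊤ : ℕ∞) (dslope Real.sinh 0) := by
  rw [contDiff_iff_contDiffAt]
  intro x
  rcases eq_or_ne x 0 with rfl | hx
  · have h1 : AnalyticAt ℝ Real.sinh 0 := Real.analyticAt_sinh
    obtain ⟨p, hp⟩ := h1
    exact hp.has_fpower_series_dslope_fslope.analyticAt.contDiffAt
  · have h2 : dslope Real.sinh 0 =ᶠ[𝓝 x] fun y => Real.sinh y / y := by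
      filter_upwards [isOpen_ne.mem_nhds hx] with y hy
      rw [dslope_of_ne _ hy, slope_def_field]
      simp
    exact (Real.contDiff_sinh.contDiffAt.div contDiffAt_id hx).congr_of_eventuallyEq h2

theorem dslope_sinh_pos (x : ℝ) : 0 < dslope Real.sinh 0 x := by
  rcases eq_or_ne x 0 with rfl | h
  · simp
  · rw [dslope_of_ne _ h, slope_def_field]
    simp only [Real.sinh_zero, sub_zero]
    rcases lt_or_gt_of_ne h with h | h
    · exact div_pos_of_neg_of_neg (Real.sinh_neg_iff.2 h) h
    · exact div_pos (Real.sinh_pos_iff.2 h) h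

theorem symbolDT_eq {δ : ℝ} (hδ : 0 < δ) (ξ : ℝ) :
    symbolDT δ ξ = -(1 / δ) *
      (Real.cosh (2 * Real.pi * δ * ξ) / dslope Real.sinh 0 (2 * Real.pi * δ * ξ)) := by
  have hpi := Real.pi_pos
  unfold symbolDT coth
  split_ifs with h
  · subst h; simp
  · have h2 : 2 * Real.pi * δ * ξ ≠ 0 := by positivity
    have h3 : Real.sinh (2 * Real.pi * δ * ξ) ≠ 0 := fun h => h2 (Real.sinh_eq_zero.1 h)
    rw [dslope_of_ne _ h2, slope_def_field]
    simp only [Real.sinh_zero, sub_zero]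
    field_simp

theorem hasDerivAt_coth {x : ℝ} (hx : x ≠ 0) : HasDerivAt coth (1 - coth x ^ 2) x := by
  have h3 : Real.sinh x ≠ 0 := fun h => hx (Real.sinh_eq_zero.1 h)
  have h := (Real.hasDerivAt_cosh x).div (Real.hasDerivAt_sinh x) h3
  refine h.congr_deriv ?_
  unfold coth
  field_simp

/-- The function `x coth x`, with value `1` at `0`. -/
def xcoth (x : ℝ) : ℝ := Real.cosh x / dslope Real.sinh 0 x

theorem xcoth_of_ne {x : ℝ} (hx : x ≠ 0) : xcoth x = x * coth x := by
  have h3 : Real.sinh x ≠ 0 := fun h => hx (Real.sinh_eq_zero.1 h)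
  unfold xcoth coth
  rw [dslope_of_ne _ hx, slope_def_field]
  simp only [Real.sinh_zero, sub_zero]
  field_simp

theorem contDiff_xcoth : ContDiff ℝ (⊤ : ℕ∞) xcoth :=
  Real.contDiff_cosh.div contDiff_dslope_sinh fun x => (dslope_sinh_pos x).ne'

theorem iteratedDeriv_xcoth (n : ℕ) : ∃ p q : Polynomial ℝ, ∀ x : ℝ, x ≠ 0 →
    iteratedDeriv n xcoth x = x * p.eval (coth x) + q.eval (coth x) := by
  induction n with
  | zero => exact ⟨Polynomial.X, 0, fun x hx => by simp [xcoth_of_ne hx]⟩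
  | succ n ih =>
    obtain ⟨p, q, h⟩ := ih
    refine ⟨p.derivative * (1 - Polynomial.X ^ 2),
      p + q.derivative * (1 - Polynomial.X ^ 2), fun x hx => ?_⟩
    have hev : iteratedDeriv n xcoth =ᶠ[𝓝 x]
        fun y => y * p.eval (coth y) + q.eval (coth y) := by
      filter_upwards [isOpen_ne.mem_nhds hx] with y hy using h y hy
    have hc := hasDerivAt_coth hx
    have hp := (p.hasDerivAt (coth x)).comp x hc
    have hq := (q.hasDerivAt (coth x)).comp x hc
    have hd := ((hasDerivAt_id x).mul hp).add hq
    rw [iteratedDeriv_succ, hev.deriv_eq]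
    refine (HasDerivAt.deriv hd).trans ?_
    simp
    ring

theorem abs_coth_le {x : ℝ} (hx : 1 ≤ |x|) : |coth x| ≤ 2 := by
  have h1 : 1 ≤ Real.sinh x ^ 2 := by
    have : 1 ≤ |Real.sinh x| := by
      rw [Real.abs_sinh]
      exact hx.trans (Real.self_le_sinh_iff.2 (abs_nonneg x))
    calc (1 : ℝ) ≤ |Real.sinh x| ^ 2 := one_le_pow₀ this
      _ = _ := sq_abs _
  have h2 : Real.cosh x ^ 2 = Real.sinh x ^ 2 + 1 := Real.cosh_sq x
  refine abs_le_of_sq_le_sq ?_ (by norm_num)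
  unfold coth
  rw [div_pow, h2, div_le_iff₀ (by linarith)]
  linarith

theorem hasTemperateGrowth_xcoth : xcoth.HasTemperateGrowth := by
  refine ⟨contDiff_xcoth, fun n => ?_⟩
  obtain ⟨p, q, h⟩ := iteratedDeriv_xcoth n
  obtain ⟨A, hA⟩ := (isCompact_Icc (a := (-2 : ℝ)) (b := 2)).exists_bound_of_continuousOn
    p.continuous.continuousOn
  obtain ⟨B, hB⟩ := (isCompact_Icc (a := (-2 : ℝ)) (b := 2)).exists_bound_of_continuousOn
    q.continuous.continuousOn
  obtain ⟨D, hD⟩ := (isCompact_Icc (a := (-1 : ℝ)) (b := 1)).exists_bound_of_continuousOn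
    (contDiff_xcoth.continuous_iteratedDeriv n (by exact_mod_cast le_top)).continuousOn
  have hA0 : 0 ≤ A := (norm_nonneg _).trans (hA 0 (by norm_num))
  have hB0 : 0 ≤ B := (norm_nonneg _).trans (hB 0 (by norm_num))
  have hD0 : 0 ≤ D := (norm_nonneg _).trans (hD 0 (by norm_num))
  refine ⟨1, A + B + D, fun x => ?_⟩
  rw [norm_iteratedFDeriv_eq_norm_iteratedDeriv, pow_one]
  have hx0 : 0 ≤ ‖x‖ := norm_nonneg x
  rcases le_total |x| 1 with hx | hx
  · have := hD x (abs_le.1 hx)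
    nlinarith [mul_nonneg (add_nonneg (add_nonneg hA0 hB0) hD0) hx0]
  · have hne : x ≠ 0 := by
      rintro rfl
      norm_num at hx
    have hc := abs_le.1 (abs_coth_le hx)
    have h1 := hA (coth x) hc
    have h2 := hB (coth x) hc
    rw [h x hne]
    have h3 : ‖x * p.eval (coth x) + q.eval (coth x)‖ ≤ ‖x‖ * A + B := by
      refine (norm_add_le _ _).trans (add_le_add ?_ h2)
      rw [norm_mul]
      exact mul_le_mul_of_nonneg_left h1 hx0
    nlinarith [mul_nonneg hB0 hx0, mul_nonneg hD0 hx0]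

theorem hasTemperateGrowth_symbolDT {δ : ℝ} (hδ : 0 < δ) :
    (fun ξ : ℝ => ((symbolDT δ ξ : ℝ) : ℂ)).HasTemperateGrowth := by
  have h1 : (fun ξ : ℝ => 2 * Real.pi * δ * ξ).HasTemperateGrowth := by fun_prop
  have h2 : (fun ξ : ℝ => xcoth (2 * Real.pi * δ * ξ)).HasTemperateGrowth :=
    hasTemperateGrowth_xcoth.comp h1
  have h3 : symbolDT δ = fun ξ : ℝ => -(1 / δ) * xcoth (2 * Real.pi * δ * ξ) := by
    ext ξ
    exact symbolDT_eq hδ ξ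
  have h4 : (symbolDT δ).HasTemperateGrowth := by
    rw [h3]
    exact (Function.HasTemperateGrowth.const (-(1 / δ))).mul h2
  exact Function.HasTemperateGrowth.comp Function.Complex.hasTemperateGrowth_ofReal h4

end

end ILW

/-!
The mass of `u` travels at bounded speed, up to an error that is visible only at scales `|x| ≲ t`.
Test the energy against the Gaussian window `ψ_R(x) = e^{-π(x/R)²}`. If, uniformly in time,

  `|d/dt ∫ u(t)² ψ_R| ≤ K / R` for all `R ≥ 1`,

then `∫ u(T)² ψ_R` and `∫ u(0)² ψ_R` differ by at most `K T / R`. Letting `R → ∞` for fixed `T`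
gives conservation of mass, so the mass of `u(T)` weighted by `1 - ψ_R` is at most that of `u(0)`
plus `K T / R`. With `R = μ(T)` both terms tend to zero, as `μ(T) → ∞` and `T / μ(T) → 0`, and
`1 - ψ_R` is bounded below where `|x| ≥ a R`. Only the lower end of the annulus matters.

The bound on the derivative is proved in Fourier variables (`exists_energy_bound`). With `w = û`,
the derivative of the energy is a bilinear form in `w` with kernel `ψ̂_R(ξ+η) η m(η)`, where
`2πiη m(η)` is the symbol of the dispersive part, plus a trilinear form with kernel
`ψ̂_R(ξ+σ+τ) (σ+τ)`. Symmetrizing in the frequencies replaces these by kernels carrying a factor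
`ζ = ξ+η`, respectively `ζ = ξ+σ+τ`: for the first because `η m(η)` is odd and `m` is Lipschitz
(`exists_disp_bound`), for the second because the cyclic average of `σ+τ` is `2ζ/3`. The `L¹` norm
of `ζ ψ̂_R(ζ)` is `O(1/R)`, and Young's inequality bounds the rest by the `H^{1/2}` norm of `u` and
the `L¹` norm of `w`, both controlled by the `H^s` norm since `s > 1/2`
(`exists_linear_flux_bound`, `exists_nonlinear_flux_bound`).

The solution is too rough to differentiate the energy directly, so `u` is first localized to
frequencies `|ξ| ≲ N`. The localized function solves the localized equation pointwise
(`hasDerivAt_localized`, by testing the equation against the transform of a plane wave times the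
cutoff). The cutoff spoils the symmetry of the trilinear form, at a cost `O(N^{-(s-1/2)})` uniform
in time, which vanishes as `N → ∞`.
-/

namespace ILW

/-! ### Young-type inequalities for multilinear forms -/

theorem lintegral_prod_convolution_le {k f g : ℝ → ℝ≥0∞} (hk : Measurable k) (hf : Measurable f)
    (hg : Measurable g) :
    ∫⁻ p : ℝ × ℝ, k (p.1 + p.2) * (f p.1 * g p.2) ≤
      (∫⁻ z, k z) * ((∫⁻ x, f x ^ (2 : ℝ)) ^ (1 / 2 : ℝ) * (∫⁻ x, g x ^ (2 : ℝ)) ^ (1 / 2 : ℝ)) := by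
  rw [Measure.volume_eq_prod, lintegral_prod _ (by fun_prop)]
  calc ∫⁻ x, ∫⁻ y, k (x + y) * (f x * g y)
      = ∫⁻ x, ∫⁻ z, k z * (f x * g (z - x)) := by
        refine lintegral_congr fun x => ?_
        rw [← lintegral_add_left_eq_self (fun z => k z * (f x * g (z - x))) x]
        simp
    _ = ∫⁻ z, ∫⁻ x, k z * (f x * g (z - x)) := by
        rw [lintegral_lintegral_swap]
        exact Measurable.aemeasurable (by fun_prop)
    _ = ∫⁻ z, k z * ∫⁻ x, f x * g (z - x) := by
        refine lintegral_congr fun z => ?_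
        rw [lintegral_const_mul _ (by fun_prop)]
    _ ≤ ∫⁻ z, k z * ((∫⁻ x, f x ^ (2 : ℝ)) ^ (1 / 2 : ℝ) *
          (∫⁻ x, g x ^ (2 : ℝ)) ^ (1 / 2 : ℝ)) := by
        refine lintegral_mono fun z => mul_le_mul_right ?_ _
        have h := ENNReal.lintegral_mul_le_Lp_mul_Lq volume Real.HolderConjugate.two_two
          hf.aemeasurable (g := fun x => g (z - x)) (by fun_prop)
        have h2 : ∫⁻ x, g (z - x) ^ (2 : ℝ) = ∫⁻ x, g x ^ (2 : ℝ) :=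
          lintegral_sub_left_eq_self (fun x => g x ^ (2 : ℝ)) z
        rw [h2] at h
        exact h
    _ = _ := by rw [lintegral_mul_const _ hk]

/-- The trilinear form is bounded by one `L¹` and two `L²` norms besides that of the kernel. -/
theorem lintegral_prod_convolution_le₃ {k f g h : ℝ → ℝ≥0∞} (hk : Measurable k)
    (hf : Measurable f) (hg : Measurable g) (hh : Measurable h) :
    ∫⁻ p : ℝ × ℝ × ℝ, k (p.1 + (p.2.1 + p.2.2)) * (f p.1 * (g p.2.1 * h p.2.2)) ≤
      (∫⁻ z, k z) * ((∫⁻ x, f x ^ (2 : ℝ)) ^ (1 / 2 : ℝ) *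
        ((∫⁻ x, g x ^ (2 : ℝ)) ^ (1 / 2 : ℝ) * ∫⁻ x, h x)) := by
  -- integrate in the variable carried by the `L¹` factor last
  have e : ∫⁻ p : ℝ × ℝ × ℝ, k (p.1 + (p.2.1 + p.2.2)) * (f p.1 * (g p.2.1 * h p.2.2)) =
      ∫⁻ z, ∫⁻ p : ℝ × ℝ, k (p.1 + p.2 + z) * (f p.1 * g p.2) * h z := by
    have hm : Measurable fun p : ℝ × ℝ × ℝ =>
        k (p.1 + (p.2.1 + p.2.2)) * (f p.1 * (g p.2.1 * h p.2.2)) := by fun_prop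
    rw [Measure.volume_eq_prod, Measure.volume_eq_prod,
      ← (measurePreserving_prodAssoc (volume : Measure ℝ) (volume : Measure ℝ)
      (volume : Measure ℝ)).lintegral_comp hm]
    refine (lintegral_prod_symm _
        (hm.comp MeasurableEquiv.prodAssoc.measurable).aemeasurable).trans ?_
    refine lintegral_congr fun z => lintegral_congr fun p => ?_
    change k (p.1 + (p.2 + z)) * (f p.1 * (g p.2 * h z)) = _
    rw [← add_assoc, mul_assoc, mul_assoc]
  rw [e]
  calc _ ≤ ∫⁻ z, ((∫⁻ z, k z) * ((∫⁻ x, f x ^ (2 : ℝ)) ^ (1 / 2 : ℝ) *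
        (∫⁻ x, g x ^ (2 : ℝ)) ^ (1 / 2 : ℝ))) * h z := by
        refine lintegral_mono fun z => ?_
        rw [lintegral_mul_const _ (by fun_prop)]
        refine mul_le_mul_left ?_ _
        have := lintegral_prod_convolution_le (k := fun x => k (x + z)) (by fun_prop) hf hg
        rwa [lintegral_add_right_eq_self (fun x => k x) z] at this
    _ = _ := by rw [lintegral_const_mul _ hh]; ring

theorem lintegral_enorm_le_of_convolution₂ {F : ℝ × ℝ → ℂ} {k f g : ℝ → ℝ} {c K a b : ℝ}
    (hc : 0 ≤ c) (hK : 0 ≤ K) (ha : 0 ≤ a) (hk : Measurable k) (hf : Measurable f) (hg : Measurable g)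
    (hF : ∀ x y, ‖F (x, y)‖ ≤ c * (‖k (x + y)‖ * (‖f x‖ * ‖g y‖)))
    (hkK : eLpNorm k 1 volume ≤ ENNReal.ofReal K) (hfa : eLpNorm f 2 volume ≤ ENNReal.ofReal a)
    (hgb : eLpNorm g 2 volume ≤ ENNReal.ofReal b) :
    ∫⁻ p, ‖F p‖ₑ ≤ ENNReal.ofReal (c * (K * (a * b))) := by
  rw [ENNReal.ofReal_mul hc, ENNReal.ofReal_mul hK, ENNReal.ofReal_mul ha]
  refine le_trans ?_ (mul_le_mul_right (mul_le_mul' hkK (mul_le_mul' hfa hgb)) _)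
  have hp : ∀ p : ℝ × ℝ, ‖F p‖ₑ ≤
      ENNReal.ofReal c * (‖k (p.1 + p.2)‖ₑ * (‖f p.1‖ₑ * ‖g p.2‖ₑ)) := by
    rintro ⟨x, y⟩
    have h := ENNReal.ofReal_le_ofReal (hF x y)
    rwa [ENNReal.ofReal_mul' (by positivity), ENNReal.ofReal_mul (by positivity),
      ENNReal.ofReal_mul (by positivity), ofReal_norm, ofReal_norm, ofReal_norm, ofReal_norm] at h
  refine (lintegral_mono hp).trans ?_
  rw [lintegral_const_mul _ (by fun_prop)]
  refine mul_le_mul_right ?_ _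
  refine (lintegral_prod_convolution_le (k := fun x => ‖k x‖ₑ) (f := fun x => ‖f x‖ₑ)
    (g := fun x => ‖g x‖ₑ) (by fun_prop) (by fun_prop) (by fun_prop)).trans (le_of_eq ?_)
  rw [eLpNorm_one_eq_lintegral_enorm, eLpNorm_eq_lintegral_rpow_enorm_toReal (by norm_num)
    (by norm_num), eLpNorm_eq_lintegral_rpow_enorm_toReal (by norm_num) (by norm_num)]
  simp

theorem lintegral_enorm_le_of_convolution₃ {F : ℝ × ℝ × ℝ → ℂ} {k f g h : ℝ → ℝ}
    {c K a b d : ℝ} (hc : 0 ≤ c) (hK : 0 ≤ K) (ha : 0 ≤ a) (hb : 0 ≤ b)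
    (hk : Measurable k) (hf : Measurable f) (hg : Measurable g) (hh : Measurable h)
    (hF : ∀ x y z, ‖F (x, y, z)‖ ≤ c * (‖k (x + (y + z))‖ * (‖f x‖ * (‖g y‖ * ‖h z‖))))
    (hkK : eLpNorm k 1 volume ≤ ENNReal.ofReal K) (hfa : eLpNorm f 2 volume ≤ ENNReal.ofReal a)
    (hgb : eLpNorm g 2 volume ≤ ENNReal.ofReal b) (hhd : eLpNorm h 1 volume ≤ ENNReal.ofReal d) :
    ∫⁻ p, ‖F p‖ₑ ≤ ENNReal.ofReal (c * (K * (a * (b * d)))) := by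
  rw [ENNReal.ofReal_mul hc, ENNReal.ofReal_mul hK, ENNReal.ofReal_mul ha, ENNReal.ofReal_mul hb]
  refine le_trans ?_ (mul_le_mul_right (mul_le_mul' hkK (mul_le_mul' hfa
    (mul_le_mul' hgb hhd))) _)
  have hp : ∀ p : ℝ × ℝ × ℝ, ‖F p‖ₑ ≤
      ENNReal.ofReal c * (‖k (p.1 + (p.2.1 + p.2.2))‖ₑ *
        (‖f p.1‖ₑ * (‖g p.2.1‖ₑ * ‖h p.2.2‖ₑ))) := by
    rintro ⟨x, y, z⟩
    have h := ENNReal.ofReal_le_ofReal (hF x y z)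
    rwa [ENNReal.ofReal_mul' (by positivity), ENNReal.ofReal_mul (by positivity),
      ENNReal.ofReal_mul (by positivity), ENNReal.ofReal_mul (by positivity),
      ofReal_norm, ofReal_norm, ofReal_norm, ofReal_norm, ofReal_norm] at h
  refine (lintegral_mono hp).trans ?_
  rw [lintegral_const_mul _ (by fun_prop)]
  refine mul_le_mul_right ?_ _
  refine (lintegral_prod_convolution_le₃ (k := fun x => ‖k x‖ₑ) (f := fun x => ‖f x‖ₑ)
    (g := fun x => ‖g x‖ₑ) (h := fun x => ‖h x‖ₑ) (by fun_prop) (by fun_prop) (by fun_prop)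
    (by fun_prop)).trans (le_of_eq ?_)
  rw [eLpNorm_one_eq_lintegral_enorm, eLpNorm_one_eq_lintegral_enorm,
    eLpNorm_eq_lintegral_rpow_enorm_toReal (by norm_num)
    (by norm_num), eLpNorm_eq_lintegral_rpow_enorm_toReal (by norm_num) (by norm_num)]
  simp

/-! ### Superpositions of plane waves -/

/-- The character `y ↦ e^{2πiy}` of the real line. -/
noncomputable def e (y : ℝ) : ℂ := Complex.exp ((2 * Real.pi * y : ℝ) * Complex.I)

theorem norm_e (y : ℝ) : ‖e y‖ = 1 := Complex.norm_exp_ofReal_mul_I _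

theorem e_add (x y : ℝ) : e (x + y) = e x * e y := by
  unfold e
  rw [← Complex.exp_add]
  congr 1
  push_cast
  ring

@[fun_prop]
theorem continuous_e : Continuous e := by unfold e; fun_prop

@[fun_prop]
theorem measurable_e : Measurable e := continuous_e.measurable

theorem contDiff_e {n : WithTop ℕ∞} : ContDiff ℝ n e := by
  unfold e
  have h1 : ContDiff ℝ n fun y : ℝ => ((2 * Real.pi * y : ℝ) : ℂ) :=
    Complex.ofRealCLM.contDiff.comp (contDiff_const.mul contDiff_id)
  exact (h1.mul contDiff_const).cexp

theorem fourierInv_eq_integral_e (f : ℝ → ℂ) (x : ℝ) :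
    FourierTransform.fourierInv f x = ∫ y, e (x * y) * f y := by
  rw [Real.fourierInv_eq']
  refine integral_congr_ae (Eventually.of_forall fun y => ?_)
  simp only [e, smul_eq_mul, RCLike.inner_apply, conj_trivial]

theorem integral_e_mul_fourier (φ : 𝓢(ℝ, ℂ)) (y : ℝ) :
    ∫ x, e (x * y) * FourierTransform.fourier φ x = φ y := by
  have h := fourierInv_eq_integral_e (FourierTransform.fourier φ : 𝓢(ℝ, ℂ)) y
  rw [← SchwartzMap.fourierInv_coe, FourierTransform.fourierInv_fourier_eq] at h
  rw [h]
  simp_rw [mul_comm y]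

section Phase

variable {Y : Type*} [MeasurableSpace Y] {ν : Measure Y}

theorem integrable_e_mul {B : Y → ℂ} (hB : Integrable B ν) {h : Y → ℝ} (hh : Measurable h)
    (x : ℝ) : Integrable (fun y => e (x * h y) * B y) ν := by
  refine hB.bdd_mul (c := 1) (Measurable.aestronglyMeasurable (by fun_prop))
    (Eventually.of_forall fun y => (norm_e _).le)

theorem norm_integral_e_mul_le {B : Y → ℂ} (h : Y → ℝ) (x : ℝ) :
    ‖∫ y, e (x * h y) * B y ∂ν‖ ≤ ∫ y, ‖B y‖ ∂ν := by
  refine (norm_integral_le_integral_norm _).trans (le_of_eq ?_)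
  simp [norm_e]

theorem integrable_phase_mul [SFinite ν] {B : Y → ℂ} (hB : Integrable B ν) {h : Y → ℝ} (hh : Measurable h)
    {g : ℝ → ℂ} (hg : Integrable g) :
    Integrable (fun p : ℝ × Y => e (p.1 * h p.2) * (g p.1 * B p.2)) (volume.prod ν) := by
  refine (hg.mul_prod hB).bdd_mul (c := 1) (Measurable.aestronglyMeasurable (by fun_prop))
    (Eventually.of_forall fun y => (norm_e _).le)

theorem integral_phase_mul [SFinite ν] {B : Y → ℂ} (hB : Integrable B ν) {h : Y → ℝ} (hh : Measurable h)
    {g : ℝ → ℂ} (hg : Integrable g) :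
    ∫ x, (∫ y, e (x * h y) * B y ∂ν) * g x = ∫ y, (∫ x, e (x * h y) * g x) * B y ∂ν := by
  have hi := integrable_phase_mul hB hh hg
  have h1 := integral_integral_swap (f := fun x y => e (x * h y) * (g x * B y)) hi
  calc _ = ∫ x, ∫ y, e (x * h y) * (g x * B y) ∂ν := by
        refine integral_congr_ae (Eventually.of_forall fun x => ?_)
        simp only
        rw [← integral_mul_const]
        congr 1; ext y; ring
    _ = _ := h1
    _ = _ := by
        refine integral_congr_ae (Eventually.of_forall fun y => ?_)
        simp only
        rw [← integral_mul_const]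
        congr 1; ext x; ring

theorem aestronglyMeasurable_integral_e_mul {B : Y → ℂ} (hB : Integrable B ν) {h : Y → ℝ}
    (hh : Measurable h) : AEStronglyMeasurable (fun x : ℝ => ∫ y, e (x * h y) * B y ∂ν) volume := by
  refine Continuous.aestronglyMeasurable ?_
  refine continuous_of_dominated (bound := fun y => ‖B y‖)
    (fun x => (integrable_e_mul hB hh x).aestronglyMeasurable)
    (fun x => Eventually.of_forall fun y => by simp [norm_e]) hB.norm
    (Eventually.of_forall fun y => by fun_prop)

theorem integral_e_mul_mul_integral_e_mul [SFinite ν] {a : ℝ → ℂ} {B : Y → ℂ} (h : Y → ℝ) (x : ℝ) :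
    (∫ ξ, e (x * ξ) * a ξ) * (∫ y, e (x * h y) * B y ∂ν) =
      ∫ p : ℝ × Y, e (x * (p.1 + h p.2)) * (a p.1 * B p.2) ∂(volume.prod ν) := by
  rw [← integral_prod_mul]
  congr 1; ext p
  rw [mul_add, e_add]; ring

theorem integral_wave_mul_wave_mul [SFinite ν] {a : ℝ → ℂ} {B : Y → ℂ} (ha : Integrable a)
    (hB : Integrable B ν) {h : Y → ℝ} (hh : Measurable h) {g : ℝ → ℂ} (hg : Integrable g) :
    ∫ x, (∫ ξ, e (x * ξ) * a ξ) * (∫ y, e (x * h y) * B y ∂ν) * g x =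
      ∫ p : ℝ × Y, (∫ x, e (x * (p.1 + h p.2)) * g x) * (a p.1 * B p.2) ∂(volume.prod ν) := by
  simp_rw [integral_e_mul_mul_integral_e_mul]
  exact integral_phase_mul (ha.mul_prod hB) (h := fun p : ℝ × Y => p.1 + h p.2) (by fun_prop) hg

end Phase

/-! ### The dispersion relation -/

theorem xcoth_neg (x : ℝ) : xcoth (-x) = xcoth x := by
  rcases eq_or_ne x 0 with rfl | hx
  · simp
  · rw [xcoth_of_ne hx, xcoth_of_ne (neg_ne_zero.2 hx), coth, coth, Real.cosh_neg, Real.sinh_neg]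
    ring

theorem xcoth_zero : xcoth 0 = 1 := by simp [xcoth]

theorem exists_lipschitz_xcoth : ∃ D : ℝ, 0 ≤ D ∧ ∀ x y, |xcoth x - xcoth y| ≤ D * |x - y| := by
  have hdiff : Differentiable ℝ xcoth := contDiff_xcoth.differentiable (by simp)
  obtain ⟨D, hD⟩ := (isCompact_Icc (a := (-1 : ℝ)) (b := 1)).exists_bound_of_continuousOn
    (contDiff_xcoth.continuous_deriv (by simp)).continuousOn
  have hD0 : 0 ≤ D := (norm_nonneg _).trans (hD 0 (by norm_num))
  have hbound : ∀ x, ‖deriv xcoth x‖ ≤ D + 3 := by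
    intro x
    rcases le_total |x| 1 with hx | hx
    · exact (hD x (abs_le.1 hx)).trans (by linarith)
    · have hne : x ≠ 0 := by
        rintro rfl
        norm_num at hx
      have hev : xcoth =ᶠ[𝓝 x] fun y => y * coth y := by
        filter_upwards [isOpen_ne.mem_nhds hne] with y hy using xcoth_of_ne hy
      have hd := (hasDerivAt_id x).mul (hasDerivAt_coth hne)
      have hs : |x| ≤ |Real.sinh x| := by
        rw [Real.abs_sinh]
        exact Real.self_le_sinh_iff.2 (abs_nonneg x)
      have hs0 : Real.sinh x ≠ 0 := fun h => hne (Real.sinh_eq_zero.1 h)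
      have h1 : 1 - coth x ^ 2 = -(1 / Real.sinh x ^ 2) := by
        unfold coth
        field_simp
        rw [Real.cosh_sq]
        ring
      have h2 : |x * (1 - coth x ^ 2)| ≤ 1 := by
        rw [h1, abs_mul, abs_neg, abs_div, abs_one, abs_pow, mul_one_div]
        refine div_le_one_of_le₀ ?_ (by positivity)
        nlinarith
      rw [hev.deriv_eq, HasDerivAt.deriv (f := fun y => y * coth y) hd, Real.norm_eq_abs]
      simp only [id, one_mul]
      exact (abs_add_le _ _).trans (by linarith [abs_coth_le hx])
  refine ⟨D + 3, by positivity, fun x y => ?_⟩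
  have := Convex.norm_image_sub_le_of_norm_deriv_le (𝕜 := ℝ) (f := xcoth) (s := Set.univ)
    (fun x _ => hdiff x) (fun x _ => hbound x) convex_univ (Set.mem_univ y) (Set.mem_univ x)
  simpa using this

/-- The real even symbol `m(ξ) = 2πξ coth(2πδξ) - 1/δ`: in Fourier variables the linear part of
the equation is `∂ₜ û = 2πiξ m(ξ) û`. -/
noncomputable def disp (δ ξ : ℝ) : ℝ := -(symbolDT δ ξ + 1 / δ)

theorem disp_eq {δ : ℝ} (hδ : 0 < δ) (ξ : ℝ) :
    disp δ ξ = 1 / δ * (xcoth (2 * Real.pi * δ * ξ) - 1) := by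
  rw [disp, symbolDT_eq hδ, xcoth]; ring

/-- `ξ m(ξ)` is odd and `m` is even and Lipschitz with `m(0) = 0`, so `ξ m(ξ) + η m(η)` vanishes on
`ξ + η = 0`. -/
theorem exists_disp_bound {δ : ℝ} (hδ : 0 < δ) : ∃ D : ℝ, 0 ≤ D ∧
    ∀ ξ η, |ξ * disp δ ξ + η * disp δ η| ≤ D * (|ξ + η| * (|ξ| + |η|)) := by
  obtain ⟨D, hD, h⟩ := exists_lipschitz_xcoth
  have hpi := Real.pi_pos
  have hsub : ∀ ξ η, |disp δ ξ - disp δ η| ≤ 2 * Real.pi * D * |ξ - η| := by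
    intro ξ η
    rw [disp_eq hδ, disp_eq hδ, ← mul_sub, abs_mul, abs_of_pos (by positivity : 0 < 1 / δ)]
    have h1 := h (2 * Real.pi * δ * ξ) (2 * Real.pi * δ * η)
    rw [← mul_sub, abs_mul, abs_of_pos (by positivity : 0 < 2 * Real.pi * δ)] at h1
    rw [sub_sub_sub_cancel_right]
    calc 1 / δ * _ ≤ 1 / δ * (D * (2 * Real.pi * δ * |ξ - η|)) := by gcongr
      _ = _ := by field_simp
  have h0 : disp δ 0 = 0 := by rw [disp_eq hδ]; simp [xcoth_zero]
  have hneg : ∀ ξ, disp δ (-ξ) = disp δ ξ := by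
    intro ξ
    rw [disp_eq hδ, disp_eq hδ, mul_neg, xcoth_neg]
  have hone : ∀ ξ, |disp δ ξ| ≤ 2 * Real.pi * D * |ξ| := fun ξ => by simpa [h0] using hsub ξ 0
  refine ⟨2 * Real.pi * D, by positivity, fun ξ η => ?_⟩
  have h2 : |disp δ η - disp δ ξ| ≤ 2 * Real.pi * D * |ξ + η| := by
    have := hsub η (-ξ)
    rwa [hneg, sub_neg_eq_add, add_comm η] at this
  calc |ξ * disp δ ξ + η * disp δ η|
      = |(ξ + η) * disp δ ξ + η * (disp δ η - disp δ ξ)| := by ring_nf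
    _ ≤ |ξ + η| * |disp δ ξ| + |η| * |disp δ η - disp δ ξ| := by
        rw [← abs_mul, ← abs_mul]; exact abs_add_le _ _
    _ ≤ |ξ + η| * (2 * Real.pi * D * |ξ|) + |η| * (2 * Real.pi * D * |ξ + η|) := by
        gcongr
        exact hone ξ
    _ = _ := by ring

theorem contDiff_disp {δ : ℝ} (hδ : 0 < δ) : ContDiff ℝ (⊤ : ℕ∞) (disp δ) := by
  have : disp δ = fun ξ => 1 / δ * (xcoth (2 * Real.pi * δ * ξ) - 1) := funext (disp_eq hδ)
  rw [this]
  exact contDiff_const.mul ((contDiff_xcoth.comp (contDiff_const.mul contDiff_id)).sub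
    contDiff_const)

/-! ### Weights -/

theorem one_add_abs_le_mul (x y : ℝ) : 1 + |y| ≤ (1 + |x + y|) * (1 + |x|) := by
  have h : |y| ≤ |x + y| + |x| := by
    calc |y| = |x + y - x| := by ring_nf
      _ ≤ _ := abs_sub _ _
  nlinarith [mul_nonneg (abs_nonneg (x + y)) (abs_nonneg x)]

theorem one_add_abs_rpow_le_mul (x y : ℝ) {θ : ℝ} (hθ : 0 ≤ θ) :
    (1 + |y|) ^ θ ≤ (1 + |x + y|) ^ θ * (1 + |x|) ^ θ := by
  rw [← Real.mul_rpow (by positivity) (by positivity)]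
  exact Real.rpow_le_rpow (by positivity) (one_add_abs_le_mul x y) hθ

theorem one_le_one_add_abs_rpow (x : ℝ) {s : ℝ} (hs : 0 ≤ s) : 1 ≤ (1 + |x|) ^ s :=
  Real.one_le_rpow (by linarith [abs_nonneg x]) hs

theorem one_add_abs_rpow_mono (x : ℝ) {r s : ℝ} (hs : r ≤ s) :
    (1 + |x|) ^ r ≤ (1 + |x|) ^ s :=
  Real.rpow_le_rpow_of_exponent_le (by linarith [abs_nonneg x]) hs

/-- Half a derivative is shared between the two factors, at the price of a weight in the
variable `x + y`. -/
theorem abs_le_weights (x y : ℝ) {s : ℝ} (hs : 1 / 2 ≤ s) :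
    |y| ≤ (1 + |x + y|) * ((1 + |x|) ^ s * (1 + |y|) ^ s) := by
  have h1 : (1 + |y|) = (1 + |y|) ^ (1 / 2 : ℝ) * (1 + |y|) ^ (1 / 2 : ℝ) := by
    rw [← Real.rpow_add (by positivity)]; norm_num
  calc |y| ≤ 1 + |y| := by linarith
    _ = (1 + |y|) ^ (1 / 2 : ℝ) * (1 + |y|) ^ (1 / 2 : ℝ) := h1
    _ ≤ ((1 + |x + y|) ^ (1 / 2 : ℝ) * (1 + |x|) ^ (1 / 2 : ℝ)) * (1 + |y|) ^ (1 / 2 : ℝ) := by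
        gcongr
        exact one_add_abs_rpow_le_mul x y (by norm_num)
    _ ≤ ((1 + |x + y|) ^ (1 : ℝ) * (1 + |x|) ^ s) * (1 + |y|) ^ s := by
        gcongr ?_ * ?_ * ?_
        · exact one_add_abs_rpow_mono _ (by norm_num)
        · exact one_add_abs_rpow_mono _ hs
        · exact one_add_abs_rpow_mono _ hs
    _ = _ := by rw [Real.rpow_one]; ring

theorem one_sub_cutoff_le {χ : ℝ → ℝ} (h0 : ∀ x, 0 ≤ χ x) {N : ℝ}
    (hN : 0 < N) (h : ∀ x, |x| ≤ N → χ x = 1) {θ : ℝ} (hθ : 0 ≤ θ) (x : ℝ) :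
    1 - χ x ≤ N ^ (-θ) * (1 + |x|) ^ θ := by
  rcases le_or_gt |x| N with hx | hx
  · rw [h x hx, sub_self]; positivity
  · have : (1 : ℝ) ≤ N ^ (-θ) * (1 + |x|) ^ θ := by
      rw [Real.rpow_neg hN.le, ← Real.inv_rpow hN.le, ← Real.mul_rpow (by positivity)
        (by positivity)]
      refine Real.one_le_rpow ?_ hθ
      rw [inv_mul_eq_div, one_le_div hN]; linarith
    linarith [h0 x]

/-- The cutoff error gains `N^{-(s-1/2)}`; of the remaining `s + 1/2` derivatives, `s` fall on `x` and
half of one on `y` or `z` (rounded up to `s`), at the price of a weight in `x + y + z`. -/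
theorem abs_one_sub_cutoff_mul_le {χ : ℝ → ℝ} (h0 : ∀ x, 0 ≤ χ x) (h1 : ∀ x, χ x ≤ 1) {N : ℝ}
    (hN : 0 < N) (h : ∀ x, |x| ≤ N → χ x = 1) {s : ℝ} (hs : 1 / 2 ≤ s) (x y z : ℝ) :
    |1 - χ x * χ (y + z)| * |y + z| ≤ 2 * N ^ (-(s - 1 / 2)) *
      ((1 + |x + (y + z)|) ^ s * ((1 + |x|) ^ s * ((1 + |y|) ^ s + (1 + |z|) ^ s))) := by
  set θ := s - 1 / 2 with hθd
  have hθ : 0 ≤ θ := by linarith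
  have a1 := one_sub_cutoff_le h0 hN h hθ x
  have a2 := one_sub_cutoff_le h0 hN h hθ (y + z)
  have b1 : |1 - χ x * χ (y + z)| ≤ N ^ (-θ) * (1 + |x|) ^ θ + N ^ (-θ) * (1 + |y + z|) ^ θ := by
    have : χ x * χ (y + z) ≤ 1 := mul_le_one₀ (h1 _) (h0 _) (h1 _)
    rw [abs_of_nonneg (by linarith)]
    nlinarith [h0 x, h1 x, h0 (y + z), h1 (y + z),
      mul_nonneg (sub_nonneg.2 (h1 x)) (sub_nonneg.2 (h1 (y + z)))]
  have b2 : |1 - χ x * χ (y + z)| ≤ 2 * N ^ (-θ) * ((1 + |x + (y + z)|) ^ θ * (1 + |x|) ^ θ) := by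
    have c1 := one_add_abs_rpow_le_mul x (y + z) hθ
    have c2 : (1 + |x|) ^ θ ≤ (1 + |x + (y + z)|) ^ θ * (1 + |x|) ^ θ :=
      le_mul_of_one_le_left (by positivity) (one_le_one_add_abs_rpow _ hθ)
    have hp : 0 ≤ N ^ (-θ) := by positivity
    nlinarith [mul_le_mul_of_nonneg_left c1 hp, mul_le_mul_of_nonneg_left c2 hp]
  have b3 : |y + z| ≤ ((1 + |x + (y + z)|) ^ (1 / 2 : ℝ) * (1 + |x|) ^ (1 / 2 : ℝ)) *
      ((1 + |y|) ^ s + (1 + |z|) ^ s) := by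
    have h2 : (1 + |y + z|) = (1 + |y + z|) ^ (1 / 2 : ℝ) * (1 + |y + z|) ^ (1 / 2 : ℝ) := by
      rw [← Real.rpow_add (by positivity)]; norm_num
    have h3 : (1 + |y + z|) ^ (1 / 2 : ℝ) ≤ (1 + |y|) ^ (1 / 2 : ℝ) + (1 + |z|) ^ (1 / 2 : ℝ) := by
      refine le_trans ?_ (Real.rpow_add_le_add_rpow (by positivity) (by positivity)
        (by norm_num) (by norm_num))
      refine Real.rpow_le_rpow (by positivity) ?_ (by norm_num)
      linarith [abs_add_le y z]
    calc |y + z| ≤ 1 + |y + z| := by linarith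
      _ = _ := h2
      _ ≤ ((1 + |x + (y + z)|) ^ (1 / 2 : ℝ) * (1 + |x|) ^ (1 / 2 : ℝ)) *
          ((1 + |y|) ^ (1 / 2 : ℝ) + (1 + |z|) ^ (1 / 2 : ℝ)) := by
        gcongr
        exact one_add_abs_rpow_le_mul x (y + z) (by norm_num)
      _ ≤ _ := by
        gcongr ?_ * (?_ + ?_)
        · exact one_add_abs_rpow_mono _ hs
        · exact one_add_abs_rpow_mono _ hs
  have hadd : ∀ x : ℝ, (1 + |x|) ^ s = (1 + |x|) ^ θ * (1 + |x|) ^ (1 / 2 : ℝ) := by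
    intro x
    rw [← Real.rpow_add (by positivity), hθd]; congr 1; ring
  calc _ ≤ (2 * N ^ (-θ) * ((1 + |x + (y + z)|) ^ θ * (1 + |x|) ^ θ)) *
        (((1 + |x + (y + z)|) ^ (1 / 2 : ℝ) * (1 + |x|) ^ (1 / 2 : ℝ)) *
      ((1 + |y|) ^ s + (1 + |z|) ^ s)) := by gcongr
    _ = _ := by rw [hadd x, hadd (x + (y + z))]; ring

/-! ### Gaussians -/

/-- The Gaussian weight `e^{-π(x/R)²}`. -/
noncomputable def gauss (R x : ℝ) : ℝ := Real.exp (-Real.pi * (x / R) ^ 2)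

/-- The Fourier transform `R e^{-π(Rζ)²}` of the Gaussian weight. -/
noncomputable def gaussHat (R ζ : ℝ) : ℝ := R * Real.exp (-Real.pi * (R * ζ) ^ 2)

@[fun_prop]
theorem continuous_gauss (R : ℝ) : Continuous (gauss R) := by unfold gauss; fun_prop

@[fun_prop]
theorem continuous_gaussHat (R : ℝ) : Continuous (gaussHat R) := by unfold gaussHat; fun_prop

theorem gauss_nonneg (R x : ℝ) : 0 ≤ gauss R x := (Real.exp_pos _).le

theorem gauss_le_one (R x : ℝ) : gauss R x ≤ 1 := by
  unfold gauss
  rw [Real.exp_le_one_iff]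
  nlinarith [Real.pi_pos, sq_nonneg (x / R)]

theorem integrable_gauss {R : ℝ} (hR : 0 < R) : Integrable (gauss R) := by
  have h := integrable_exp_neg_mul_sq (b := Real.pi / R ^ 2) (by positivity)
  refine h.congr (Eventually.of_forall fun x => ?_)
  simp only [gauss]
  congr 1
  field_simp

theorem integral_e_mul_gauss {R : ℝ} (hR : 0 < R) (ζ : ℝ) :
    ∫ x, e (x * ζ) * (gauss R x : ℂ) = (gaussHat R ζ : ℂ) := by
  have hb : 0 < ((1 / R ^ 2 : ℝ) : ℂ).re := by
    rw [Complex.ofReal_re]; positivity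
  have h := congrFun (fourier_gaussian_pi hb) (-ζ)
  rw [← Real.fourierInv_eq_fourier_neg, fourierInv_eq_integral_e] at h
  have e1 : ∫ x, e (x * ζ) * (gauss R x : ℂ) =
      ∫ y, e (ζ * y) * Complex.exp (-Real.pi * ((1 / R ^ 2 : ℝ) : ℂ) * (y : ℂ) ^ 2) := by
    refine integral_congr_ae (Eventually.of_forall fun x => ?_)
    simp only [gauss]
    rw [mul_comm x]
    push_cast
    congr 2
    field_simp
  rw [e1, h, gaussHat]
  have e2 : ((1 / R ^ 2 : ℝ) : ℂ) ^ (1 / 2 : ℂ) = ((1 / R : ℝ) : ℂ) := by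
    have h3 : ((1 / 2 : ℝ) : ℂ) = (1 / 2 : ℂ) := by push_cast; rfl
    rw [← h3, ← Complex.ofReal_cpow (by positivity)]
    congr 1
    rw [← Real.sqrt_eq_rpow, show (1 / R ^ 2 : ℝ) = (1 / R) ^ 2 by ring,
      Real.sqrt_sq (by positivity)]
  rw [e2]
  have hR' : (R : ℂ) ≠ 0 := by exact_mod_cast hR.ne'
  push_cast
  congr 1
  · field_simp
  · congr 1; field_simp

theorem integrable_weight_mul_exp {c : ℝ} (hc : 0 < c) (s : ℝ) (hs : 0 ≤ s) :
    Integrable fun z : ℝ => (1 + |z|) ^ s * Real.exp (-c * z ^ 2) := by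
  have h := (integrable_exp_neg_mul_sq (b := c / 2) (by positivity)).const_mul
    (Real.exp (s ^ 2 / (2 * c)))
  refine h.mono' (Continuous.aestronglyMeasurable ?_) (Eventually.of_forall fun z => ?_)
  · refine Continuous.mul (Continuous.rpow_const (by fun_prop) fun x => Or.inr hs) (by fun_prop)
  · rw [Real.norm_of_nonneg (by positivity), ← Real.exp_add]
    have h1 : (1 + |z|) ^ s ≤ Real.exp (|z| * s) := by
      rw [Real.exp_mul]
      refine Real.rpow_le_rpow (by positivity) ?_ hs
      linarith [Real.add_one_le_exp |z|]
    refine (mul_le_mul_of_nonneg_right h1 (Real.exp_pos _).le).trans ?_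
    rw [← Real.exp_add]
    refine Real.exp_le_exp.2 ?_
    have h2 : s ^ 2 / (2 * c) + -(c / 2) * z ^ 2 - (|z| * s + -c * z ^ 2) =
        (s - c * |z|) ^ 2 / (2 * c) := by
      field_simp
      rw [← sq_abs z]
      ring
    have h3 : 0 ≤ (s - c * |z|) ^ 2 / (2 * c) := by positivity
    linarith

theorem integrable_weight_mul_gaussHat {R : ℝ} (hR : 0 < R) {s : ℝ} (hs : 0 ≤ s) :
    Integrable fun z : ℝ => (1 + |z|) ^ s * gaussHat R z := by
  refine ((integrable_weight_mul_exp (c := Real.pi * R ^ 2)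
    (by positivity) s hs).const_mul R).congr (Eventually.of_forall fun x => ?_)
  simp only [gaussHat]
  rw [mul_left_comm]
  congr 3
  ring

/-- The factor `z` in front of the transform of the weight `x ↦ e^{-π(x/R)²}` gains `1/R`. -/
theorem exists_eLpNorm_gaussHat_le : ∃ K : ℝ, 0 ≤ K ∧ ∀ R : ℝ, 1 ≤ R →
    eLpNorm (fun z => z * ((1 + |z|) * gaussHat R z)) 1 volume ≤ ENNReal.ofReal (K / R) := by
  set κ : ℝ → ℝ := fun z => (1 + |z|) ^ (2 : ℝ) * Real.exp (-Real.pi * z ^ 2) with hκ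
  have hκi : Integrable κ := integrable_weight_mul_exp Real.pi_pos 2 (by norm_num)
  have hκ0 : ∀ z, 0 ≤ κ z := fun z => by positivity
  refine ⟨∫ z, κ z, integral_nonneg hκ0, fun R hR => ?_⟩
  have hR0 : 0 < R := by linarith
  have h2 : (∫ z, κ z) / R = ∫ z, κ (R * z) := by
    rw [Measure.integral_comp_mul_left κ R, abs_of_pos (by positivity), smul_eq_mul]
    ring
  rw [eLpNorm_one_eq_lintegral_enorm, h2, ofReal_integral_eq_lintegral_ofReal
    (hκi.comp_mul_left' hR0.ne') (Eventually.of_forall fun z => hκ0 _)]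
  refine lintegral_mono fun z => ?_
  rw [← ofReal_norm]
  refine ENNReal.ofReal_le_ofReal ?_
  simp only [hκ, gaussHat, Real.norm_eq_abs, abs_mul, Real.abs_exp, Real.rpow_two, abs_of_pos hR0]
  rw [abs_of_pos (by positivity : 0 < 1 + |z|)]
  have : |z| * ((1 + |z|) * R) ≤ (1 + R * |z|) ^ 2 := by
    have hz := abs_nonneg z
    nlinarith [mul_nonneg hz hz, mul_nonneg (mul_nonneg hz hz) (mul_nonneg hR0.le
      (sub_nonneg.2 hR)), mul_nonneg hz hR0.le]
  calc |z| * ((1 + |z|) * (R * Real.exp (-Real.pi * (R * z) ^ 2)))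
      = |z| * ((1 + |z|) * R) * Real.exp (-Real.pi * (R * z) ^ 2) := by ring
    _ ≤ _ := by gcongr

/-! ### The energy flux in Fourier variables -/

/-- The weight `(1+|ξ|)^s |w(ξ)|`, whose `L²` norm is an `H^s` norm if `w` is a Fourier
transform. -/
noncomputable def wt (s : ℝ) (w : ℝ → ℂ) (ξ : ℝ) : ℝ := (1 + |ξ|) ^ s * ‖w ξ‖

/-- `w` is the Fourier transform of an element of `H^s`, with `H^s` norm and `L¹` norm of the
transform controlled by `A`. -/
structure IsProfile (s A : ℝ) (w : ℝ → ℂ) : Prop where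
  measurable : Measurable w
  nonneg : 0 ≤ A
  eLpNorm_wt : eLpNorm (wt s w) 2 volume ≤ ENNReal.ofReal A
  eLpNorm_one : eLpNorm (fun ξ => ‖w ξ‖) 1 volume ≤ ENNReal.ofReal A

/-- A frequency cutoff equal to `1` on `[-N, N]`. -/
structure IsCutoff (N : ℝ) (χ : ℝ → ℝ) : Prop where
  contDiff : ContDiff ℝ (⊤ : ℕ∞) χ
  compact : HasCompactSupport χ
  nonneg : ∀ x, 0 ≤ χ x
  le_one : ∀ x, χ x ≤ 1
  eq_one : ∀ x, |x| ≤ N → χ x = 1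

theorem exists_isCutoff {N : ℝ} (hN : 0 < N) : ∃ χ, IsCutoff N χ := by
  let b : ContDiffBump (0 : ℝ) := ⟨N, N + 1, hN, by linarith⟩
  refine ⟨b, b.contDiff, b.hasCompactSupport, fun _ => b.nonneg, fun _ => b.le_one,
    fun x hx => b.one_of_mem_closedBall ?_⟩
  simpa using hx

section

variable {s A N : ℝ} {w : ℝ → ℂ} {χ : ℝ → ℝ}

theorem IsProfile.measurable_wt (hw : IsProfile s A w) (hs : 0 ≤ s) : Measurable (wt s w) := by
  have : Measurable fun ξ : ℝ => (1 + |ξ|) ^ s :=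
    (Continuous.rpow_const (by fun_prop) fun x => Or.inr hs).measurable
  exact this.mul hw.measurable.norm

theorem IsProfile.integrable (hw : IsProfile s A w) : Integrable w := by
  refine ⟨hw.measurable.aestronglyMeasurable, ?_⟩
  have h := hw.eLpNorm_one
  rw [eLpNorm_norm, eLpNorm_one_eq_lintegral_enorm] at h
  exact h.trans_lt ENNReal.ofReal_lt_top

theorem IsProfile.integral_norm_le (hw : IsProfile s A w) : ∫ ξ, ‖w ξ‖ ≤ A := by
  have h := hw.eLpNorm_one
  rw [eLpNorm_norm, eLpNorm_one_eq_lintegral_enorm,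
    ← ofReal_integral_norm_eq_lintegral_enorm hw.integrable] at h
  exact (ENNReal.ofReal_le_ofReal_iff hw.nonneg).1 h

theorem norm_wt (s : ℝ) (w : ℝ → ℂ) (ξ : ℝ) : ‖wt s w ξ‖ = (1 + |ξ|) ^ s * ‖w ξ‖ :=
  Real.norm_of_nonneg (by unfold wt; positivity)

theorem norm_le_norm_wt (hs : 0 ≤ s) (w : ℝ → ℂ) (ξ : ℝ) : ‖w ξ‖ ≤ ‖wt s w ξ‖ := by
  rw [norm_wt]
  exact le_mul_of_one_le_left (norm_nonneg _) (one_le_one_add_abs_rpow _ hs)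

theorem norm_integral_le_of_lintegral_enorm_le {α : Type*} [MeasurableSpace α] {μ : Measure α}
    {F : α → ℂ} {X : ℝ} (hX : 0 ≤ X) (h : ∫⁻ p, ‖F p‖ₑ ∂μ ≤ ENNReal.ofReal X) :
    ‖∫ p, F p ∂μ‖ ≤ X := by
  have h1 := (enorm_integral_le_lintegral_enorm F).trans h
  rw [← ofReal_norm] at h1
  exact (ENNReal.ofReal_le_ofReal_iff hX).1 h1

theorem IsCutoff.exists_bound (hχ : IsCutoff N χ) {q : ℝ → ℂ} (hq : Continuous q) :
    ∃ C, ∀ x, ‖q x * χ x‖ ≤ C := by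
  have hc : HasCompactSupport fun x => q x * (χ x : ℂ) :=
    (hχ.compact.comp_left (g := fun r : ℝ => (r : ℂ)) Complex.ofReal_zero).mul_left
  have hχc := hχ.contDiff.continuous
  exact hc.exists_bound_of_continuous (by fun_prop)

theorem IsProfile.integrable_cutoff_mul (hw : IsProfile s A w) (hχ : IsCutoff N χ) {q : ℝ → ℂ}
    (hq : Continuous q) : Integrable fun ξ => q ξ * χ ξ * w ξ := by
  obtain ⟨C, hC⟩ := hχ.exists_bound hq
  have hχc := hχ.contDiff.continuous
  exact hw.integrable.bdd_mul (c := C) (Continuous.aestronglyMeasurable (by fun_prop))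
    (Eventually.of_forall hC)

theorem IsProfile.integrable_cutoff_mul_prod (hw : IsProfile s A w) (hχ : IsCutoff N χ) {q : ℝ → ℂ}
    (hq : Continuous q) :
    Integrable fun p : ℝ × ℝ => q (p.1 + p.2) * χ (p.1 + p.2) * (w p.1 * w p.2) := by
  obtain ⟨C, hC⟩ := hχ.exists_bound hq
  have hχc := hχ.contDiff.continuous
  exact (hw.integrable.mul_prod hw.integrable).bdd_mul (c := C)
    (Continuous.aestronglyMeasurable (by fun_prop)) (Eventually.of_forall fun p => hC _)

theorem norm_gaussHat_le {R : ℝ} (hR : 0 < R) (z : ℝ) : ‖(gaussHat R z : ℂ)‖ ≤ R := by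
  rw [Complex.norm_real, gaussHat, Real.norm_of_nonneg (by positivity)]
  refine mul_le_of_le_one_right hR.le (Real.exp_le_one_iff.2 ?_)
  nlinarith [Real.pi_pos, sq_nonneg (R * z)]

/-- The symbol `2πiη m(η)` of the dispersive part of the equation. -/
noncomputable def linSymbol (δ η : ℝ) : ℂ := 2 * Real.pi * Complex.I * (η * disp δ η : ℝ)

/-- The symbol `2πiη` of the derivative. -/
noncomputable def derivSymbol (η : ℝ) : ℂ := 2 * Real.pi * Complex.I * (η : ℝ)

@[fun_prop]
theorem continuous_derivSymbol : Continuous derivSymbol := by unfold derivSymbol; fun_prop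

theorem continuous_linSymbol {δ : ℝ} (hδ : 0 < δ) : Continuous (linSymbol δ) := by
  have := (contDiff_disp hδ).continuous
  unfold linSymbol; fun_prop

/-- The dispersive part of the energy flux. The symbol `η m(η)` is odd, so symmetrization brings
out the factor `|ξ + η|`, which is `O(1/R)` against the transform of the weight. -/
theorem exists_linear_flux_bound {δ : ℝ} (hδ : 0 < δ) (s : ℝ) (hs : 1 / 2 ≤ s) : ∃ K : ℝ, 0 ≤ K ∧
    ∀ R, 1 ≤ R → ∀ (N A : ℝ) (χ : ℝ → ℝ) (w : ℝ → ℂ), IsCutoff N χ → IsProfile s A w →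
    ‖∫ p : ℝ × ℝ, (gaussHat R (p.1 + p.2) : ℂ) * (((χ p.1 : ℂ) * w p.1) *
      (linSymbol δ p.2 * χ p.2 * w p.2))‖ ≤ K * A ^ 2 / R := by
  obtain ⟨D, hD, hD2⟩ := exists_disp_bound hδ
  obtain ⟨K, hK, hKR⟩ := exists_eLpNorm_gaussHat_le
  refine ⟨2 * Real.pi * D * K, by have := Real.pi_pos; positivity,
    fun R hR N A χ w hχ hw => ?_⟩
  have hR0 : 0 < R := by linarith
  have hA := hw.nonneg
  have hpi := Real.pi_pos
  set F : ℝ × ℝ → ℂ := fun p => (gaussHat R (p.1 + p.2) : ℂ) * (((χ p.1 : ℂ) * w p.1) *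
      (linSymbol δ p.2 * χ p.2 * w p.2)) with hF
  have hFi : Integrable F := by
    have h1 := hw.integrable_cutoff_mul hχ (q := fun _ => 1) continuous_const
    have h2 := hw.integrable_cutoff_mul hχ (continuous_linSymbol hδ)
    simp only [one_mul] at h1
    exact (h1.mul_prod h2).bdd_mul (c := R) (Continuous.aestronglyMeasurable (by fun_prop))
      (Eventually.of_forall fun p => norm_gaussHat_le hR0 _)
  have hsymm : (2 : ℂ) * ∫ p, F p = ∫ p, (F p + F p.swap) := by
    have h3 : ∫ p : ℝ × ℝ, F p.swap = ∫ p, F p := integral_prod_swap F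
    have h4 : ∫ p, (F p + F p.swap) = (∫ p, F p) + ∫ p : ℝ × ℝ, F p.swap :=
      integral_add hFi hFi.swap
    rw [h4, h3, two_mul]
  have hb : ∀ x y, ‖F (x, y) + F (x, y).swap‖ ≤ (2 * Real.pi * D * 2) *
      (‖(x + y) * ((1 + |x + y|) * gaussHat R (x + y))‖ * (‖wt s w x‖ * ‖wt s w y‖)) := by
    intro x y
    have h4 : F (x, y) + F (x, y).swap = ((gaussHat R (x + y) * (χ x * χ y) : ℝ) : ℂ) *
        (2 * Real.pi * Complex.I) * ((x * disp δ x + y * disp δ y : ℝ) : ℂ) * (w x * w y) := by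
      simp only [hF, Prod.swap_prod_mk, linSymbol, add_comm y x]
      push_cast
      ring
    have h5 : ‖(2 * Real.pi * Complex.I : ℂ)‖ = 2 * Real.pi := by
      simp [abs_of_pos hpi]
    have h6 : |x * disp δ x + y * disp δ y| ≤ D * (|x + y| * (2 * ((1 + |x + y|) *
        ((1 + |x|) ^ s * (1 + |y|) ^ s)))) := by
      refine (hD2 x y).trans ?_
      have a1 := abs_le_weights x y hs
      have a2 := abs_le_weights y x hs
      rw [add_comm y x, mul_comm ((1 + |y|) ^ s)] at a2
      gcongr
      linarith
    have hg : 0 ≤ gaussHat R (x + y) := by unfold gaussHat; positivity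
    have h7 : |gaussHat R (x + y) * (χ x * χ y)| ≤ gaussHat R (x + y) := by
      rw [abs_mul, abs_of_nonneg hg]
      refine mul_le_of_le_one_right hg ?_
      rw [abs_of_nonneg (mul_nonneg (hχ.nonneg _) (hχ.nonneg _))]
      exact mul_le_one₀ (hχ.le_one _) (hχ.nonneg _) (hχ.le_one _)
    rw [h4, norm_mul, norm_mul, norm_mul, h5, Complex.norm_real, Complex.norm_real,
      norm_mul (w x), Real.norm_eq_abs, Real.norm_eq_abs, norm_wt, norm_wt, Real.norm_eq_abs,
      abs_mul (x + y), abs_mul (1 + |x + y|), abs_of_nonneg hg,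
      abs_of_pos (by positivity : 0 < 1 + |x + y|)]
    calc _ ≤ gaussHat R (x + y) * (2 * Real.pi) * (D * (|x + y| * (2 * ((1 + |x + y|) *
        ((1 + |x|) ^ s * (1 + |y|) ^ s))))) * (‖w x‖ * ‖w y‖) := by gcongr
      _ = _ := by ring
  have hmk : Measurable fun z => z * ((1 + |z|) * gaussHat R z) :=
    Continuous.measurable (by fun_prop)
  have hmw := hw.measurable_wt (by linarith)
  have h9 : ‖∫ p, (F p + F p.swap)‖ ≤ (2 * Real.pi * D * 2) * (K / R * (A * A)) := by
    have := hKR R hR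
    exact norm_integral_le_of_lintegral_enorm_le (by positivity)
      (lintegral_enorm_le_of_convolution₂ (F := fun p => F p + F p.swap) (by positivity)
        (by positivity) hA hmk hmw hmw hb this hw.eLpNorm_wt hw.eLpNorm_wt)
  rw [← hsymm, norm_mul, Complex.norm_ofNat] at h9
  calc _ ≤ (2 * Real.pi * D * 2) * (K / R * (A * A)) / 2 := by linarith
    _ = _ := by ring

/-- The cyclic permutation `(x, y, z) ↦ (y, z, x)`. -/
def cyc : ℝ × ℝ × ℝ ≃ᵐ ℝ × ℝ × ℝ :=
  (MeasurableEquiv.prodComm (α := ℝ) (β := ℝ × ℝ)).trans MeasurableEquiv.prodAssoc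

theorem measurePreserving_cyc : MeasurePreserving cyc volume volume :=
  (measurePreserving_prodAssoc (volume : Measure ℝ) (volume : Measure ℝ)
    (volume : Measure ℝ)).comp Measure.measurePreserving_swap

theorem three_mul_integral_eq_of_cyc {G H : ℝ × ℝ × ℝ → ℂ} (hG : Integrable G)
    (h : ∀ x y z, G (x, y, z) + G (y, z, x) + G (z, x, y) = H (x, y, z)) :
    3 * ∫ p, G p = ∫ p, H p := by
  have i1 : Integrable (fun p => G (cyc p)) :=
    (measurePreserving_cyc.integrable_comp_emb cyc.measurableEmbedding).2 hG
  have i2 : Integrable (fun p => G (cyc (cyc p))) :=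
    (measurePreserving_cyc.integrable_comp_emb cyc.measurableEmbedding).2 i1
  have e1 : ∫ p, G (cyc p) = ∫ p, G p := measurePreserving_cyc.integral_comp' G
  have e2 : ∫ p, G (cyc (cyc p)) = ∫ p, G (cyc p) :=
    measurePreserving_cyc.integral_comp' fun p => G (cyc p)
  have e3 : ∫ p, H p = ∫ p, (G p + G (cyc p) + G (cyc (cyc p))) := by
    refine integral_congr_ae (Eventually.of_forall ?_)
    rintro ⟨x, y, z⟩
    exact (h x y z).symm
  have e4 := integral_add (hG.add i1) i2
  have e5 := integral_add hG i1
  simp only [Pi.add_apply] at e4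
  rw [e3, e4, e5, e2, e1]
  ring

/-- The nonlinear part of the energy flux. Without the cutoff, symmetrization in the three
frequencies brings out the factor `ξ + σ + τ`, which is `O(1/R)` against the transform of the
weight; as `s > 1/2`, the cutoff at frequency `N` costs a negative power of `N`. -/
theorem exists_nonlinear_flux_bound (s : ℝ) (hs : 1 / 2 ≤ s) : ∃ K : ℝ, 0 ≤ K ∧
    ∀ R, 1 ≤ R → ∃ K' : ℝ, 0 ≤ K' ∧
    ∀ (N A : ℝ) (χ : ℝ → ℝ) (w : ℝ → ℂ), 0 < N → IsCutoff N χ → IsProfile s A w →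
    ‖∫ p : ℝ × ℝ × ℝ, (gaussHat R (p.1 + (p.2.1 + p.2.2)) : ℂ) * (((χ p.1 : ℂ) * w p.1) *
      (derivSymbol (p.2.1 + p.2.2) * χ (p.2.1 + p.2.2) * (w p.2.1 * w p.2.2)))‖ ≤
      K * A ^ 3 / R + K' * A ^ 3 * N ^ (-(s - 1 / 2)) := by
  obtain ⟨K, hK, hKR⟩ := exists_eLpNorm_gaussHat_le
  have hpi := Real.pi_pos
  refine ⟨2 * Real.pi * K, by positivity, fun R hR => ?_⟩
  have hR0 : 0 < R := by linarith
  set k : ℝ → ℝ := fun z => (1 + |z|) ^ s * gaussHat R z with hk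
  have hki : Integrable k := integrable_weight_mul_gaussHat hR0 (by linarith)
  have hkc : Measurable k := by
    have : Measurable fun ξ : ℝ => (1 + |ξ|) ^ s :=
      (Continuous.rpow_const (by fun_prop) fun x => Or.inr (by linarith)).measurable
    fun_prop
  obtain ⟨L, hL0, hL⟩ : ∃ L : ℝ, 0 ≤ L ∧ eLpNorm k 1 volume = ENNReal.ofReal L := by
    refine ⟨∫ z, ‖k z‖, by positivity, ?_⟩
    rw [eLpNorm_one_eq_lintegral_enorm, ofReal_integral_norm_eq_lintegral_enorm hki]
  refine ⟨2 * Real.pi * 2 * L * 2, by positivity, fun N A χ w hN hχ hw => ?_⟩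
  have hA := hw.nonneg
  have hwm := hw.measurable
  have hmw := hw.measurable_wt (by linarith)
  have h5 : ‖(2 * Real.pi * Complex.I : ℂ)‖ = 2 * Real.pi := by simp [abs_of_pos hpi]
  have hg : ∀ z, 0 ≤ gaussHat R z := fun z => by unfold gaussHat; positivity
  set G : ℝ × ℝ × ℝ → ℂ := fun p => (gaussHat R (p.1 + (p.2.1 + p.2.2)) : ℂ) *
    (((χ p.1 : ℂ) * w p.1) *
      (derivSymbol (p.2.1 + p.2.2) * χ (p.2.1 + p.2.2) * (w p.2.1 * w p.2.2))) with hG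
  set G₁ : ℝ × ℝ × ℝ → ℂ := fun p => (gaussHat R (p.1 + (p.2.1 + p.2.2)) : ℂ) *
    (w p.1 * (derivSymbol (p.2.1 + p.2.2) * (w p.2.1 * w p.2.2))) with hG₁
  have hGi : Integrable G := by
    have h1 := hw.integrable_cutoff_mul hχ (q := fun _ => 1) continuous_const
    have h2 := hw.integrable_cutoff_mul_prod hχ continuous_derivSymbol
    simp only [one_mul] at h1
    exact (h1.mul_prod h2).bdd_mul (c := R) (Continuous.aestronglyMeasurable (by fun_prop))
      (Eventually.of_forall fun p => norm_gaussHat_le hR0 _)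
  -- the difference `G₁ - G` is split according to the factor that takes the half derivative
  set E : ℝ × ℝ × ℝ → ℝ := fun p => 2 * Real.pi * (2 * N ^ (-(s - 1 / 2))) *
    (k (p.1 + (p.2.1 + p.2.2)) * (wt s w p.1 * (wt s w p.2.1 * ‖w p.2.2‖))) with hE
  set E' : ℝ × ℝ × ℝ → ℝ := fun p => 2 * Real.pi * (2 * N ^ (-(s - 1 / 2))) *
    (k (p.1 + (p.2.1 + p.2.2)) * (wt s w p.1 * (wt s w p.2.2 * ‖w p.2.1‖))) with hE'
  have hdiff : ∀ p, ‖G₁ p - G p‖ ≤ E p + E' p := by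
    rintro ⟨x, y, z⟩
    have e1 : G₁ (x, y, z) - G (x, y, z) = (gaussHat R (x + (y + z)) : ℂ) *
        (2 * Real.pi * Complex.I) * ((1 - χ x * χ (y + z) : ℝ) : ℂ) * ((y + z : ℝ) : ℂ) *
        (w x * (w y * w z)) := by
      simp only [hG, hG₁, derivSymbol]
      push_cast
      ring
    have e2 := abs_one_sub_cutoff_mul_le hχ.nonneg hχ.le_one hN hχ.eq_one hs x y z
    rw [e1, norm_mul, norm_mul, norm_mul, norm_mul, h5, norm_mul, norm_mul, Complex.norm_real,
      Complex.norm_real, Complex.norm_real, Real.norm_of_nonneg (hg _), Real.norm_eq_abs,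
      Real.norm_eq_abs]
    have := hg (x + (y + z))
    calc _ = gaussHat R (x + (y + z)) * (2 * Real.pi) * (|1 - χ x * χ (y + z)| * |y + z|) *
          (‖w x‖ * (‖w y‖ * ‖w z‖)) := by ring
      _ ≤ gaussHat R (x + (y + z)) * (2 * Real.pi) * (2 * N ^ (-(s - 1 / 2)) *
      ((1 + |x + (y + z)|) ^ s * ((1 + |x|) ^ s * ((1 + |y|) ^ s + (1 + |z|) ^ s)))) *
          (‖w x‖ * (‖w y‖ * ‖w z‖)) := by gcongr
      _ = _ := by simp only [hE, hE', hk, wt]; ring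
  have hEn : ∫⁻ p, ‖((E p : ℝ) : ℂ)‖ₑ ≤
      ENNReal.ofReal (2 * Real.pi * (2 * N ^ (-(s - 1 / 2))) * (L * (A * (A * A)))) := by
    refine lintegral_enorm_le_of_convolution₃ (by positivity) hL0 hA hA
      hkc hmw hmw hwm.norm (fun x y z => ?_) hL.le hw.eLpNorm_wt hw.eLpNorm_wt hw.eLpNorm_one
    rw [Complex.norm_real]
    simp only [hE, norm_mul, norm_norm]
    rw [Real.norm_of_nonneg (by positivity : 0 ≤ N ^ (-(s - 1 / 2))), Real.norm_ofNat,
      Real.norm_of_nonneg hpi.le]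
  have hEn' : ∫⁻ p, ‖((E' p : ℝ) : ℂ)‖ₑ = ∫⁻ p, ‖((E p : ℝ) : ℂ)‖ₑ := by
    have hsw : MeasurePreserving (Prod.map id Prod.swap : ℝ × ℝ × ℝ → ℝ × ℝ × ℝ) volume volume :=
      (MeasurePreserving.id volume).prod Measure.measurePreserving_swap
    have hEm : Measurable fun p => ‖((E p : ℝ) : ℂ)‖ₑ := by
      simp only [hE]; fun_prop
    rw [← hsw.lintegral_comp hEm]
    refine lintegral_congr ?_
    rintro ⟨x, y, z⟩
    simp only [hE, hE', Prod.map, id, Prod.swap_prod_mk, add_comm z y]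
  have hdl : ∫⁻ p, ‖G₁ p - G p‖ₑ ≤
      ENNReal.ofReal (2 * Real.pi * 2 * L * 2 * A ^ 3 * N ^ (-(s - 1 / 2))) := by
    calc _ ≤ ∫⁻ p, (‖((E p : ℝ) : ℂ)‖ₑ + ‖((E' p : ℝ) : ℂ)‖ₑ) := by
          refine lintegral_mono fun p => ?_
          rw [← ofReal_norm, ← ofReal_norm, ← ofReal_norm, ← ENNReal.ofReal_add (norm_nonneg _)
            (norm_nonneg _)]
          refine ENNReal.ofReal_le_ofReal ((hdiff p).trans ?_)
          rw [Complex.norm_real, Complex.norm_real]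
          exact add_le_add (le_abs_self _) (le_abs_self _)
      _ ≤ _ := by
          have hEm : Measurable fun p => ‖((E p : ℝ) : ℂ)‖ₑ := by simp only [hE]; fun_prop
          rw [lintegral_add_left hEm, hEn']
          refine (add_le_add hEn hEn).trans ?_
          rw [← ENNReal.ofReal_add (by positivity) (by positivity)]
          refine ENNReal.ofReal_le_ofReal (le_of_eq ?_)
          ring
  have hG₁m : Measurable G₁ := by simp only [hG₁]; fun_prop
  have hDi : Integrable fun p => G₁ p - G p :=
    ⟨hG₁m.aestronglyMeasurable.sub hGi.aestronglyMeasurable, hdl.trans_lt ENNReal.ofReal_lt_top⟩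
  have hG₁i : Integrable G₁ := by
    refine (hDi.add hGi).congr (Eventually.of_forall fun p => ?_)
    simp
  have hsym := three_mul_integral_eq_of_cyc (H := fun p => (gaussHat R (p.1 + (p.2.1 + p.2.2)) : ℂ) *
    (2 * derivSymbol (p.1 + (p.2.1 + p.2.2))) * (w p.1 * (w p.2.1 * w p.2.2))) hG₁i (by
      intro x y z
      have r1 : y + (z + x) = x + (y + z) := by ring
      have r2 : z + (x + y) = x + (y + z) := by ring
      simp only [hG₁, derivSymbol, r1, r2]
      push_cast
      ring)
  have hmain : ‖3 * ∫ p, G₁ p‖ ≤ (2 * (2 * Real.pi)) * (K / R * (A * (A * A))) := by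
    rw [hsym]
    refine norm_integral_le_of_lintegral_enorm_le (by positivity) ?_
    refine lintegral_enorm_le_of_convolution₃ (by positivity) (by positivity) hA hA
      (k := fun z => z * ((1 + |z|) * gaussHat R z)) (Continuous.measurable (by fun_prop))
      hmw hmw hwm.norm (fun x y z => ?_) (hKR R hR) hw.eLpNorm_wt hw.eLpNorm_wt hw.eLpNorm_one
    have a1 := norm_le_norm_wt (s := s) (by linarith) w x
    have a2 := norm_le_norm_wt (s := s) (by linarith) w y
    have a3 : (1 : ℝ) ≤ ‖1 + |x + (y + z)|‖ := by
      rw [Real.norm_of_nonneg (by positivity)]; linarith [abs_nonneg (x + (y + z))]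
    have a4 : ‖derivSymbol (x + (y + z))‖ = 2 * Real.pi * ‖x + (y + z)‖ := by
      rw [derivSymbol, norm_mul, h5, Complex.norm_real]
    rw [norm_mul, norm_mul, norm_mul 2, a4, norm_mul (w x), norm_mul (w y), Complex.norm_real,
      Complex.norm_ofNat, norm_mul (x + (y + z)), norm_mul (1 + |x + (y + z)|), norm_norm]
    calc _ = (2 * (2 * Real.pi)) * (‖x + (y + z)‖ * (1 * ‖gaussHat R (x + (y + z))‖) *
          (‖w x‖ * (‖w y‖ * ‖w z‖))) := by ring
      _ ≤ _ := by gcongr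
  rw [norm_mul, Complex.norm_ofNat] at hmain
  have herr := norm_integral_le_of_lintegral_enorm_le (by positivity) hdl
  rw [integral_sub hG₁i hGi] at herr
  have hX : 0 ≤ 2 * Real.pi * (K / R * (A * (A * A))) := by positivity
  have e9 : 2 * Real.pi * K * A ^ 3 / R = 2 * Real.pi * (K / R * (A * (A * A))) := by ring
  rw [e9]
  have := norm_sub_norm_le (∫ p, G p) (∫ p, G₁ p)
  rw [norm_sub_rev] at this
  linarith

end

/-! ### The equation in Fourier variables -/

theorem toDist_apply {p : ℝ≥0∞} [Fact (1 ≤ p)] (f : Lp ℝ p (volume : Measure ℝ)) (φ : 𝓢(ℝ, ℂ)) :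
    toDist f φ = ∫ x, φ x * (f x : ℂ) := by
  rw [toDist, Lp.toTemperedDistribution_apply]
  refine integral_congr_ae ?_
  filter_upwards [Complex.ofRealCLM.coeFn_compLp f] with x hx
  rw [hx]
  rfl

theorem memLp_one_add_abs_rpow {s : ℝ} (hs : 1 / 2 < s) :
    MemLp (fun ξ : ℝ => (1 + |ξ|) ^ (-s)) 2 volume := by
  have hc : Continuous fun ξ : ℝ => (1 + |ξ|) ^ (-s) :=
    Continuous.rpow_const (by fun_prop) fun x => Or.inl (by positivity)
  rw [memLp_two_iff_integrable_sq hc.aestronglyMeasurable]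
  have h := integrable_one_add_norm (E := ℝ) (μ := volume) (r := 2 * s) (by simp; linarith)
  refine h.congr (Eventually.of_forall fun x => ?_)
  simp only [Real.norm_eq_abs]
  rw [← Real.rpow_natCast, ← Real.rpow_mul (by positivity)]
  congr 1
  push_cast
  ring

/-- The bound on the transform of a function `u` with `⟨D⟩^s u = v ∈ L²`. It has an `L¹` part
because `s > 1/2`. -/
theorem exists_isProfile {s : ℝ} (hs : 1 / 2 < s) (C : ℝ) : ∃ A : ℝ,
    ∀ v : Lp ℂ 2 (volume : Measure ℝ), ‖v‖ ≤ C →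
      IsProfile s A fun ξ => (((1 + ‖ξ‖ ^ 2) ^ (-s / 2) : ℝ) : ℂ) * FourierTransform.fourier v ξ := by
  obtain ⟨B, hB0, hB⟩ : ∃ B : ℝ, 0 ≤ B ∧
      eLpNorm (fun ξ : ℝ => (1 + |ξ|) ^ (-s)) 2 volume = ENNReal.ofReal B :=
    ⟨_, ENNReal.toReal_nonneg, (ENNReal.ofReal_toReal (memLp_one_add_abs_rpow hs).2.ne).symm⟩
  set A₀ : ℝ := 2 ^ (s / 2) * |C| with hA₀
  refine ⟨A₀ + B * A₀, fun v hv => ?_⟩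
  set w : ℝ → ℂ := fun ξ =>
    (((1 + ‖ξ‖ ^ 2) ^ (-s / 2) : ℝ) : ℂ) * FourierTransform.fourier v ξ with hw
  have hmeas : Measurable w := by
    have h1 : Measurable fun ξ : ℝ => (1 + ‖ξ‖ ^ 2) ^ (-s / 2) :=
      (Continuous.rpow_const (by fun_prop) fun x => Or.inl (by positivity)).measurable
    have h2 : Measurable (FourierTransform.fourier v : Lp ℂ 2 (volume : Measure ℝ)) :=
      (Lp.stronglyMeasurable _).measurable
    exact (Complex.measurable_ofReal.comp h1).mul h2
  have hwt : ∀ ξ, ‖wt s w ξ‖ ≤ 2 ^ (s / 2) * ‖FourierTransform.fourier v ξ‖ := by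
    intro ξ
    rw [norm_wt, hw]
    simp only [norm_mul, Complex.norm_real]
    rw [Real.norm_of_nonneg (by positivity), ← mul_assoc]
    refine mul_le_mul_of_nonneg_right ?_ (norm_nonneg _)
    have h1 : (1 + |ξ|) ^ s = ((1 + |ξ|) ^ 2) ^ (s / 2) := by
      rw [← Real.rpow_natCast, ← Real.rpow_mul (by positivity)]
      congr 1; push_cast; ring
    have h2 : (1 + |ξ|) ^ 2 ≤ 2 * (1 + ‖ξ‖ ^ 2) := by
      rw [Real.norm_eq_abs]; nlinarith [sq_nonneg (1 - |ξ|)]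
    calc (1 + |ξ|) ^ s * (1 + ‖ξ‖ ^ 2) ^ (-s / 2)
        ≤ (2 * (1 + ‖ξ‖ ^ 2)) ^ (s / 2) * (1 + ‖ξ‖ ^ 2) ^ (-s / 2) := by
          rw [h1]; gcongr
      _ = 2 ^ (s / 2) := by
          rw [Real.mul_rpow (by positivity) (by positivity), mul_assoc,
            ← Real.rpow_add (by positivity)]
          simp [neg_div]
  have hA₀0 : 0 ≤ A₀ := by positivity
  have h2 : eLpNorm (wt s w) 2 volume ≤ ENNReal.ofReal A₀ := by
    refine (eLpNorm_le_mul_eLpNorm_of_ae_le_mul (Eventually.of_forall hwt) 2).trans ?_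
    rw [hA₀, ENNReal.ofReal_mul (by positivity)]
    refine mul_le_mul_right ?_ _
    rw [← Lp.enorm_def, ← ofReal_norm, Lp.norm_fourier_eq]
    exact ENNReal.ofReal_le_ofReal (hv.trans (le_abs_self _))
  refine ⟨hmeas, by positivity, h2.trans (ENNReal.ofReal_le_ofReal ?_), ?_⟩
  · linarith [mul_nonneg hB0 hA₀0]
  · have hmw : Measurable (wt s w) := by
      have : Measurable fun ξ : ℝ => (1 + |ξ|) ^ s :=
        (Continuous.rpow_const (by fun_prop) fun x => Or.inr (by linarith)).measurable
      exact this.mul hmeas.norm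
    have h3 : (fun ξ => ‖w ξ‖) = (fun ξ : ℝ => (1 + |ξ|) ^ (-s)) • wt s w := by
      ext ξ
      simp only [Pi.smul_apply', smul_eq_mul, wt]
      rw [← mul_assoc, ← Real.rpow_add (by positivity)]
      simp
    rw [h3]
    refine (eLpNorm_smul_le_mul_eLpNorm (p := 2) (q := 2) (r := 1) hmw.aestronglyMeasurable
      (memLp_one_add_abs_rpow hs).1).trans ?_
    rw [hB]
    refine (mul_le_mul_right h2 _).trans ?_
    rw [← ENNReal.ofReal_mul hB0]
    exact ENNReal.ofReal_le_ofReal (by linarith)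

/-- The Fourier transform of `f`, if `⟨D⟩^s f = v`, is the function `(1+ξ²)^{-s/2} v̂(ξ)`. -/
theorem toDist_fourier_eq {s : ℝ} {f : Lp ℝ 2 (volume : Measure ℝ)}
    {v : Lp ℂ 2 (volume : Measure ℝ)}
    (h : TemperedDistribution.besselPotential ℝ ℂ s (toDist f) = Lp.toTemperedDistribution v)
    (φ : 𝓢(ℝ, ℂ)) : toDist f (FourierTransform.fourier φ) =
      ∫ ξ, φ ξ * ((((1 + ‖ξ‖ ^ 2) ^ (-s / 2) : ℝ) : ℂ) * FourierTransform.fourier v ξ) := by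
  rw [← (TemperedDistribution.besselPotential_neg_apply_eq_iff s _ _).2 h,
    TemperedDistribution.besselPotential, TemperedDistribution.fourierMultiplierCLM_apply,
    TemperedDistribution.fourierInv_apply, FourierTransform.fourierInv_fourier_eq,
    TemperedDistribution.smulLeftCLM_apply_apply, Lp.fourier_toTemperedDistribution_eq,
    Lp.toTemperedDistribution_apply]
  refine integral_congr_ae (Eventually.of_forall fun ξ => ?_)
  have ht : Function.HasTemperateGrowth
      fun x : ℝ => (((1 + ‖x‖ ^ 2) ^ (-s / 2) : ℝ) : ℂ) := by fun_prop
  simp only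
  rw [SchwartzMap.smulLeftCLM_apply_apply ht, smul_eq_mul, smul_eq_mul]
  ring

section

variable {s A : ℝ} {w : ℝ → ℂ} {f : Lp ℝ 2 (volume : Measure ℝ)}

/-- `f` is the superposition of plane waves with amplitude `w`. -/
theorem coe_ae_eq_integral_e (hw : IsProfile s A w)
    (h : ∀ φ : 𝓢(ℝ, ℂ), toDist f (FourierTransform.fourier φ) = ∫ ξ, φ ξ * w ξ) :
    ∀ᵐ x : ℝ, (f x : ℂ) = ∫ ξ, e (x * ξ) * w ξ := by
  have hcont : Continuous fun x : ℝ => ∫ ξ, e (x * ξ) * w ξ :=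
    continuous_of_dominated (bound := fun y => ‖w y‖)
      (fun x => (integrable_e_mul hw.integrable (h := id) measurable_id x).aestronglyMeasurable)
      (fun x => Eventually.of_forall fun y => by simp [norm_e]) hw.integrable.norm
      (Eventually.of_forall fun y => by fun_prop)
  have hloc : LocallyIntegrable (fun x => (f x : ℂ)) volume :=
    ((Lp.memLp f).ofReal (K := ℂ)).locallyIntegrable (by norm_num)
  refine ae_eq_of_integral_contDiff_smul_eq hloc hcont.locallyIntegrable fun g hg hgc => ?_
  have hgc' : HasCompactSupport fun x => (g x : ℂ) :=
    hgc.comp_left (g := fun r : ℝ => (r : ℂ)) Complex.ofReal_zero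
  let ψ : 𝓢(ℝ, ℂ) := hgc'.toSchwartzMap (Complex.ofRealCLM.contDiff.comp hg)
  have hψ : ∀ x, ψ x = (g x : ℂ) := fun x => rfl
  have h1 := h (FourierTransform.fourierInv ψ)
  rw [FourierTransform.fourier_fourierInv_eq, toDist_apply] at h1
  have h2 := integral_phase_mul hw.integrable (h := id) measurable_id
    (SchwartzMap.integrable (μ := volume) (FourierTransform.fourier (FourierTransform.fourierInv ψ)))
  simp only [id, integral_e_mul_fourier] at h2
  simp only [Complex.real_smul, ← hψ]
  rw [h1, ← h2, FourierTransform.fourier_fourierInv_eq]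
  simp_rw [mul_comm]

/-- The Fourier transform of `f²` is the convolution `w * w`, paired with `φ`. -/
theorem toDist_sqL1_fourier (hw : IsProfile s A w)
    (h : ∀ φ : 𝓢(ℝ, ℂ), toDist f (FourierTransform.fourier φ) = ∫ ξ, φ ξ * w ξ) (φ : 𝓢(ℝ, ℂ)) :
    toDist (sqL1 f) (FourierTransform.fourier φ) =
      ∫ p : ℝ × ℝ, φ (p.1 + p.2) * (w p.1 * w p.2) := by
  have h2 := integral_wave_mul_wave_mul hw.integrable hw.integrable (h := id) measurable_id
    (SchwartzMap.integrable (μ := volume) (FourierTransform.fourier φ))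
  simp only [id, integral_e_mul_fourier] at h2
  rw [Measure.volume_eq_prod, ← h2, toDist_apply]
  refine integral_congr_ae ?_
  have h3 : (sqL1 f : ℝ → ℝ) =ᵐ[volume] (f : ℝ → ℝ) • (f : ℝ → ℝ) := Lp.coeFn_lpSMul f f
  filter_upwards [h3, coe_ae_eq_integral_e hw h] with x hx1 hx2
  rw [hx1, ← hx2]
  simp
  ring

theorem hasTemperateGrowth_derivSymbol : Function.HasTemperateGrowth derivSymbol := by
  unfold derivSymbol; fun_prop

theorem neg_derivCLM_fourier (φ : 𝓢(ℝ, ℂ)) :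
    -(SchwartzMap.derivCLM ℂ ℂ) (FourierTransform.fourier φ) =
      FourierTransform.fourier (SchwartzMap.smulLeftCLM ℂ derivSymbol φ) := by
  ext x
  have hi : Integrable fun x : ℝ => x • φ x := by
    have := SchwartzMap.integrable (μ := volume) (SchwartzMap.smulLeftCLM ℂ (fun x : ℝ => (x : ℂ)) φ)
    refine this.congr (Eventually.of_forall fun x => ?_)
    simp only
    rw [SchwartzMap.smulLeftCLM_apply_apply (by fun_prop)]
    simp
  have h1 := congrFun (Real.deriv_fourier (SchwartzMap.integrable (μ := volume) φ) hi) x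
  rw [neg_apply, SchwartzMap.derivCLM_apply, SchwartzMap.fourier_coe, h1,
    SchwartzMap.fourier_coe, Real.fourier_eq', Real.fourier_eq', ← integral_neg]
  refine integral_congr_ae (Eventually.of_forall fun ξ => ?_)
  simp only
  rw [SchwartzMap.smulLeftCLM_apply_apply hasTemperateGrowth_derivSymbol, derivSymbol]
  simp only [smul_eq_mul]
  ring

theorem derivCLM_apply_fourier (T : 𝓢'(ℝ, ℂ)) (φ : 𝓢(ℝ, ℂ)) :
    TemperedDistribution.derivCLM ℂ T (FourierTransform.fourier φ) =
      T (FourierTransform.fourier (SchwartzMap.smulLeftCLM ℂ derivSymbol φ)) := by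
  rw [TemperedDistribution.derivCLM_apply_apply, neg_derivCLM_fourier]

theorem opDT_apply_fourier {δ : ℝ} (T : 𝓢'(ℝ, ℂ)) (φ : 𝓢(ℝ, ℂ)) :
    opDT δ T (FourierTransform.fourier φ) = T (FourierTransform.fourier
      (SchwartzMap.smulLeftCLM ℂ (fun ξ : ℝ => ((symbolDT δ ξ : ℝ) : ℂ)) φ)) := by
  rw [opDT, TemperedDistribution.fourierMultiplierCLM_apply,
    TemperedDistribution.fourierInv_apply, FourierTransform.fourierInv_fourier_eq,
    TemperedDistribution.smulLeftCLM_apply_apply, TemperedDistribution.fourier_apply]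

/-- The equation in Fourier variables: `∂ₜ w = 2πiξ (m w - (w * w) / 2)`, paired with `φ`. -/
theorem neg_spatialPart_fourier {δ : ℝ} (hδ : 0 < δ) (hw : IsProfile s A w)
    (h : ∀ φ : 𝓢(ℝ, ℂ), toDist f (FourierTransform.fourier φ) = ∫ ξ, φ ξ * w ξ) (φ : 𝓢(ℝ, ℂ)) :
    -(spatialPart δ f (FourierTransform.fourier φ)) =
      (∫ ξ, linSymbol δ ξ * φ ξ * w ξ) -
        (1 / 2 : ℂ) * ∫ p : ℝ × ℝ, derivSymbol (p.1 + p.2) * φ (p.1 + p.2) * (w p.1 * w p.2) := by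
  have h1 : spatialPart δ f (FourierTransform.fourier φ) =
      TemperedDistribution.derivCLM ℂ (opDT δ (toDist f)) (FourierTransform.fourier φ)
      + ((1 / δ : ℝ) : ℂ) * TemperedDistribution.derivCLM ℂ (toDist f) (FourierTransform.fourier φ)
      + (1 / 2 : ℂ) *
        TemperedDistribution.derivCLM ℂ (toDist (sqL1 f)) (FourierTransform.fourier φ) := rfl
  have hst := hasTemperateGrowth_symbolDT hδ
  have hi : ∀ φ : 𝓢(ℝ, ℂ), Integrable fun ξ => φ ξ * w ξ := by
    intro φ
    obtain ⟨C, hC⟩ := φ.decay 0 0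
    refine hw.integrable.bdd_mul (c := C) φ.continuous.aestronglyMeasurable
      (Eventually.of_forall fun x => ?_)
    simpa using hC.2 x
  rw [h1, derivCLM_apply_fourier, derivCLM_apply_fourier, derivCLM_apply_fourier,
    opDT_apply_fourier, h, h, toDist_sqL1_fourier hw h]
  have e2 : ∀ ξ, SchwartzMap.smulLeftCLM ℂ derivSymbol φ ξ = derivSymbol ξ * φ ξ := fun ξ =>
    SchwartzMap.smulLeftCLM_apply_apply hasTemperateGrowth_derivSymbol φ ξ
  have e3 : ∫ ξ, linSymbol δ ξ * φ ξ * w ξ = -((∫ ξ, SchwartzMap.smulLeftCLM ℂ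
      (fun ξ : ℝ => ((symbolDT δ ξ : ℝ) : ℂ)) (SchwartzMap.smulLeftCLM ℂ derivSymbol φ) ξ * w ξ) +
      ((1 / δ : ℝ) : ℂ) * ∫ ξ, SchwartzMap.smulLeftCLM ℂ derivSymbol φ ξ * w ξ) := by
    rw [← integral_const_mul, ← integral_add (hi _) ((hi _).const_mul _), ← integral_neg]
    refine integral_congr_ae (Eventually.of_forall fun ξ => ?_)
    simp only
    rw [SchwartzMap.smulLeftCLM_apply_apply hst, e2, linSymbol, derivSymbol, disp, smul_eq_mul]
    push_cast
    ring
  rw [e3]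
  simp only [e2]
  ring

end

/-! ### Frequency-localized solutions -/

/-- The function with Fourier transform `χ w`. -/
noncomputable def localized (χ : ℝ → ℝ) (w : ℝ → ℂ) (x : ℝ) : ℂ :=
  ∫ ξ, e (x * ξ) * ((χ ξ : ℂ) * w ξ)

/-- The frequency-localized right-hand side of the equation for a solution with Fourier
transform `w`. -/
noncomputable def localizedRHS (δ : ℝ) (χ : ℝ → ℝ) (w : ℝ → ℂ) (x : ℝ) : ℂ :=
  (∫ ξ, e (x * ξ) * (linSymbol δ ξ * χ ξ * w ξ)) - (1 / 2 : ℂ) *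
    ∫ p : ℝ × ℝ, e (x * (p.1 + p.2)) *
      (derivSymbol (p.1 + p.2) * χ (p.1 + p.2) * (w p.1 * w p.2))

section

variable {s A N δ : ℝ} {w : ℝ → ℂ} {χ : ℝ → ℝ}

theorem IsProfile.integrable_cutoff (hw : IsProfile s A w) (hχ : IsCutoff N χ) :
    Integrable fun ξ => (χ ξ : ℂ) * w ξ := by
  simpa using hw.integrable_cutoff_mul hχ (q := fun _ => 1) continuous_const

theorem norm_localized_le (hw : IsProfile s A w) (hχ : IsCutoff N χ) (x : ℝ) :
    ‖localized χ w x‖ ≤ A := by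
  refine (norm_integral_e_mul_le (fun ξ => ξ) x).trans ((integral_mono
    (hw.integrable_cutoff hχ).norm hw.integrable.norm fun ξ => ?_).trans hw.integral_norm_le)
  simp only [norm_mul, Complex.norm_real]
  refine mul_le_of_le_one_left (norm_nonneg _) ?_
  rw [Real.norm_of_nonneg (hχ.nonneg _)]
  exact hχ.le_one _

theorem exists_norm_localizedRHS_le (hδ : 0 < δ) (hχ : IsCutoff N χ) (s A : ℝ) : ∃ B : ℝ,
    ∀ w, IsProfile s A w → ∀ x, ‖localizedRHS δ χ w x‖ ≤ B := by
  obtain ⟨C₁, h₁⟩ := hχ.exists_bound (continuous_linSymbol hδ)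
  obtain ⟨C₂, h₂⟩ := hχ.exists_bound continuous_derivSymbol
  have hC₁ : 0 ≤ C₁ := (norm_nonneg _).trans (h₁ 0)
  have hC₂ : 0 ≤ C₂ := (norm_nonneg _).trans (h₂ 0)
  refine ⟨C₁ * A + 1 / 2 * (C₂ * (A * A)), fun w hw x => ?_⟩
  have hA := hw.nonneg
  refine (norm_sub_le _ _).trans (add_le_add ?_ ?_)
  · refine (norm_integral_e_mul_le (fun ξ => ξ) x).trans ?_
    calc _ ≤ ∫ ξ, C₁ * ‖w ξ‖ := by
          refine integral_mono (hw.integrable_cutoff_mul hχ (continuous_linSymbol hδ)).norm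
            (hw.integrable.norm.const_mul _) fun ξ => ?_
          simp only [norm_mul _ (w ξ)]
          exact mul_le_mul_of_nonneg_right (h₁ ξ) (norm_nonneg _)
      _ ≤ _ := by
          rw [integral_const_mul]
          exact mul_le_mul_of_nonneg_left hw.integral_norm_le hC₁
  · rw [norm_mul]
    refine mul_le_mul (by norm_num) ?_ (norm_nonneg _) (by norm_num)
    refine (norm_integral_e_mul_le (fun p : ℝ × ℝ => p.1 + p.2) x).trans ?_
    calc _ ≤ ∫ p : ℝ × ℝ, C₂ * (‖w p.1‖ * ‖w p.2‖) := by
          refine integral_mono (hw.integrable_cutoff_mul_prod hχ continuous_derivSymbol).norm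
            ((hw.integrable.norm.mul_prod hw.integrable.norm).const_mul _) fun p => ?_
          simp only [norm_mul _ (w p.1 * w p.2), norm_mul (w p.1)]
          exact mul_le_mul_of_nonneg_right (h₂ _) (by positivity)
      _ ≤ _ := by
          have : ∫ p : ℝ × ℝ, ‖w p.1‖ * ‖w p.2‖ = (∫ ξ, ‖w ξ‖) * ∫ ξ, ‖w ξ‖ :=
            integral_prod_mul (fun ξ => ‖w ξ‖) (fun ξ => ‖w ξ‖)
          rw [integral_const_mul, this]
          have := hw.integral_norm_le
          gcongr

theorem aestronglyMeasurable_localized (hw : IsProfile s A w) (hχ : IsCutoff N χ) :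
    AEStronglyMeasurable (localized χ w) volume :=
  aestronglyMeasurable_integral_e_mul (hw.integrable_cutoff hχ) (h := fun ξ => ξ) measurable_id

theorem aestronglyMeasurable_localizedRHS (hδ : 0 < δ) (hw : IsProfile s A w)
    (hχ : IsCutoff N χ) : AEStronglyMeasurable (localizedRHS δ χ w) volume :=
  (aestronglyMeasurable_integral_e_mul (hw.integrable_cutoff_mul hχ (continuous_linSymbol hδ))
    (h := fun ξ => ξ) measurable_id).sub
    ((aestronglyMeasurable_integral_e_mul
      (hw.integrable_cutoff_mul_prod hχ continuous_derivSymbol)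
      (h := fun p : ℝ × ℝ => p.1 + p.2) (by fun_prop)).const_mul _)

/-- The energy flux through the weight is the sum of the two multilinear forms estimated above. -/
theorem integral_localized_mul_localizedRHS (hδ : 0 < δ) (hw : IsProfile s A w)
    (hχ : IsCutoff N χ) {R : ℝ} (hR : 0 < R) :
    ∫ x, localized χ w x * localizedRHS δ χ w x * (gauss R x : ℂ) =
      (∫ p : ℝ × ℝ, (gaussHat R (p.1 + p.2) : ℂ) * (((χ p.1 : ℂ) * w p.1) *
        (linSymbol δ p.2 * χ p.2 * w p.2))) - (1 / 2 : ℂ) *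
      ∫ p : ℝ × ℝ × ℝ, (gaussHat R (p.1 + (p.2.1 + p.2.2)) : ℂ) * (((χ p.1 : ℂ) * w p.1) *
        (derivSymbol (p.2.1 + p.2.2) * χ (p.2.1 + p.2.2) * (w p.2.1 * w p.2.2))) := by
  have hg : Integrable fun x => (gauss R x : ℂ) := (integrable_gauss hR).ofReal
  have h1 := integral_wave_mul_wave_mul (hw.integrable_cutoff hχ)
    (hw.integrable_cutoff_mul hχ (continuous_linSymbol hδ)) (h := fun ξ => ξ) measurable_id hg
  have h2 := integral_wave_mul_wave_mul (hw.integrable_cutoff hχ)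
    (hw.integrable_cutoff_mul_prod hχ continuous_derivSymbol)
    (h := fun p : ℝ × ℝ => p.1 + p.2) (by fun_prop) hg
  simp only [integral_e_mul_gauss hR] at h1 h2
  have hbound : ∀ {Y : Type} [MeasurableSpace Y] {ν : Measure Y} [SFinite ν] {B : Y → ℂ}
      (_ : Integrable B ν) {h : Y → ℝ} (_ : Measurable h),
      Integrable fun x => localized χ w x * (∫ y, e (x * h y) * B y ∂ν) * (gauss R x : ℂ) := by
    intro Y _ ν _ B hB h hh
    refine hg.bdd_mul (c := A * ∫ y, ‖B y‖ ∂ν) ((aestronglyMeasurable_localized hw hχ).mul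
      (aestronglyMeasurable_integral_e_mul hB hh)) (Eventually.of_forall fun x => ?_)
    rw [norm_mul]
    exact mul_le_mul (norm_localized_le hw hχ x) (norm_integral_e_mul_le h x) (norm_nonneg _)
      hw.nonneg
  have i1 := hbound (hw.integrable_cutoff_mul hχ (continuous_linSymbol hδ)) (h := fun ξ => ξ)
    measurable_id
  have i2 := hbound (hw.integrable_cutoff_mul_prod hχ continuous_derivSymbol)
    (h := fun p : ℝ × ℝ => p.1 + p.2) (by fun_prop)
  rw [Measure.volume_eq_prod, Measure.volume_eq_prod ℝ (ℝ × ℝ), ← h1, ← h2,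
    ← integral_const_mul]
  refine Eq.trans ?_ (integral_sub i1 (i2.const_mul (1 / 2 : ℂ)))
  refine integral_congr_ae (Eventually.of_forall fun x => ?_)
  simp only [localizedRHS, localized]
  ring

theorem tendsto_integral_localized_sq {χ : ℕ → ℝ → ℝ} (hχ : ∀ n : ℕ, IsCutoff (n + 1) (χ n))
    (hw : IsProfile s A w) {R : ℝ} (hR : 0 < R) :
    Tendsto (fun n => ∫ x, localized (χ n) w x ^ 2 * (gauss R x : ℂ)) atTop
      (𝓝 (∫ x, (∫ ξ, e (x * ξ) * w ξ) ^ 2 * (gauss R x : ℂ))) := by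
  have hpt : ∀ x, Tendsto (fun n => localized (χ n) w x) atTop (𝓝 (∫ ξ, e (x * ξ) * w ξ)) := by
    intro x
    refine tendsto_integral_of_dominated_convergence (fun ξ => ‖w ξ‖)
      (fun n => (integrable_e_mul (hw.integrable_cutoff (hχ n)) (h := fun ξ => ξ) measurable_id
        x).aestronglyMeasurable) hw.integrable.norm (fun n => Eventually.of_forall fun ξ => ?_)
      (Eventually.of_forall fun ξ => ?_)
    · rw [norm_mul, norm_mul, norm_e, one_mul, Complex.norm_real,
        Real.norm_of_nonneg ((hχ n).nonneg _)]
      exact mul_le_of_le_one_left (norm_nonneg _) ((hχ n).le_one _)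
    · refine tendsto_const_nhds.congr' ?_
      obtain ⟨n₀, hn₀⟩ := exists_nat_ge |ξ|
      filter_upwards [eventually_ge_atTop n₀] with n hn
      have : |ξ| ≤ (n : ℝ) + 1 := by
        have : (n₀ : ℝ) ≤ n := by exact_mod_cast hn
        linarith
      rw [(hχ n).eq_one ξ this]
      simp
  refine tendsto_integral_of_dominated_convergence (fun x => A ^ 2 * gauss R x)
    (fun n => ((aestronglyMeasurable_localized hw (hχ n)).pow 2).mul
      (Continuous.aestronglyMeasurable (by fun_prop))) ((integrable_gauss hR).const_mul _)
    (fun n => Eventually.of_forall fun x => ?_)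
    (Eventually.of_forall fun x => ((hpt x).pow 2).mul_const _)
  rw [norm_mul, norm_pow, Complex.norm_real, Real.norm_of_nonneg (gauss_nonneg _ _)]
  have := norm_localized_le hw (hχ n) x
  have := gauss_nonneg R x
  gcongr

end

section

variable {s A N δ : ℝ} {u : ℝ → Lp ℝ 2 (volume : Measure ℝ)} {w : ℝ → ℝ → ℂ} {χ : ℝ → ℝ}

/-- The localized solution is differentiable in time at every point `x`: it is the pairing of `u`
with the transform of the Schwartz function `ξ ↦ e^{2πixξ} χ(ξ)`. -/
theorem hasDerivAt_localized (hδ : 0 < δ) (hu : IsSolution δ u) (hw : ∀ t, IsProfile s A (w t))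
    (h : ∀ t (φ : 𝓢(ℝ, ℂ)), toDist (u t) (FourierTransform.fourier φ) = ∫ ξ, φ ξ * w t ξ)
    (hχ : IsCutoff N χ) (x t : ℝ) :
    HasDerivAt (fun t => localized χ (w t) x) (localizedRHS δ χ (w t) x) t := by
  have hc : HasCompactSupport fun ξ => e (x * ξ) * (χ ξ : ℂ) :=
    (hχ.compact.comp_left (g := fun r : ℝ => (r : ℂ)) Complex.ofReal_zero).mul_left
  have hsm : ContDiff ℝ (⊤ : ℕ∞) fun ξ => e (x * ξ) * (χ ξ : ℂ) :=
    (contDiff_e.comp (contDiff_const.mul contDiff_id)).mul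
      (Complex.ofRealCLM.contDiff.comp hχ.contDiff)
  let φ : 𝓢(ℝ, ℂ) := hc.toSchwartzMap hsm
  have hφ : ∀ ξ, φ ξ = e (x * ξ) * (χ ξ : ℂ) := fun ξ => rfl
  have h1 := hu (FourierTransform.fourier φ) t
  rw [neg_spatialPart_fourier hδ (hw t) (h t)] at h1
  simp only [h, hφ] at h1
  convert h1 using 1
  · ext t
    simp only [localized, mul_assoc]
  · simp only [localizedRHS]
    congr 2
    · ext ξ; ring
    · congr 1; ext p; ring

theorem hasDerivAt_integral_localized_sq (hδ : 0 < δ) (hu : IsSolution δ u)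
    (hw : ∀ t, IsProfile s A (w t))
    (h : ∀ t (φ : 𝓢(ℝ, ℂ)), toDist (u t) (FourierTransform.fourier φ) = ∫ ξ, φ ξ * w t ξ)
    (hχ : IsCutoff N χ) {R : ℝ} (hR : 0 < R) (t : ℝ) :
    HasDerivAt (fun t => ∫ x, localized χ (w t) x ^ 2 * (gauss R x : ℂ))
      (2 * ∫ x, localized χ (w t) x * localizedRHS δ χ (w t) x * (gauss R x : ℂ)) t := by
  obtain ⟨B, hB⟩ := exists_norm_localizedRHS_le hδ hχ s A
  have hA := (hw 0).nonneg
  have hg : Integrable fun x => (gauss R x : ℂ) := (integrable_gauss hR).ofReal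
  have hloc := fun t => aestronglyMeasurable_localized (hw t) hχ
  have hgm : AEStronglyMeasurable (fun x => (gauss R x : ℂ)) volume := hg.aestronglyMeasurable
  have h1 : ∀ t, AEStronglyMeasurable (fun x => localized χ (w t) x ^ 2 * (gauss R x : ℂ)) volume :=
    fun t => ((hloc t).pow 2).mul hgm
  have h2 : Integrable fun x => localized χ (w t) x ^ 2 * (gauss R x : ℂ) := by
    refine hg.bdd_mul (c := A ^ 2) ((hloc t).pow 2) (Eventually.of_forall fun x => ?_)
    rw [norm_pow]
    exact pow_le_pow_left₀ (norm_nonneg _) (norm_localized_le (hw t) hχ x) 2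
  have h3 : AEStronglyMeasurable (fun x => 2 * (localized χ (w t) x * localizedRHS δ χ (w t) x *
      (gauss R x : ℂ))) volume :=
    (((hloc t).mul (aestronglyMeasurable_localizedRHS hδ (hw t) hχ)).mul hgm).const_mul 2
  have h4 : ∀ x t, ‖2 * (localized χ (w t) x * localizedRHS δ χ (w t) x * (gauss R x : ℂ))‖ ≤
      2 * (A * B * gauss R x) := by
    intro x t
    rw [norm_mul, norm_mul, norm_mul, Complex.norm_ofNat, Complex.norm_real,
      Real.norm_of_nonneg (gauss_nonneg _ _)]
    refine mul_le_mul_of_nonneg_left (mul_le_mul_of_nonneg_right ?_ (gauss_nonneg _ _))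
      (by norm_num)
    exact mul_le_mul (norm_localized_le (hw t) hχ x) (hB _ (hw t) x) (norm_nonneg _) hA
  have h5 : ∀ x t, HasDerivAt (fun t => localized χ (w t) x ^ 2 * (gauss R x : ℂ))
      (2 * (localized χ (w t) x * localizedRHS δ χ (w t) x * (gauss R x : ℂ))) t := by
    intro x t
    have h1 := ((hasDerivAt_localized hδ hu hw h hχ x t).pow 2).mul_const (gauss R x : ℂ)
    refine h1.congr_deriv ?_
    push_cast
    ring
  have key := hasDerivAt_integral_of_dominated_loc_of_deriv_le (μ := volume) (𝕜 := ℝ) (x₀ := t)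
    (F := fun t x => localized χ (w t) x ^ 2 * (gauss R x : ℂ))
    (F' := fun t x => 2 * (localized χ (w t) x * localizedRHS δ χ (w t) x * (gauss R x : ℂ)))
    (bound := fun x => 2 * (A * B * gauss R x)) (univ_mem (f := 𝓝 t))
    (Eventually.of_forall h1) h2 h3 (Eventually.of_forall fun x t _ => h4 x t)
    (((integrable_gauss hR).const_mul _).const_mul _) (Eventually.of_forall fun x t _ => h5 x t)
  rw [← integral_const_mul]
  exact key.2

/-! ### Propagation of the energy -/

/-- The energy in a window of width `R` changes at a rate `O(1/R)`. -/
theorem exists_energy_bound (hδ : 0 < δ) (hs : 1 / 2 < s) (hu : IsSolution δ u)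
    (hw : ∀ t, IsProfile s A (w t))
    (h : ∀ t (φ : 𝓢(ℝ, ℂ)), toDist (u t) (FourierTransform.fourier φ) = ∫ ξ, φ ξ * w t ξ) :
    ∃ K : ℝ, 0 ≤ K ∧ ∀ R, 1 ≤ R → ∀ T, 0 ≤ T →
      |(∫ x, u T x ^ 2 * gauss R x) - ∫ x, u 0 x ^ 2 * gauss R x| ≤ K * T / R := by
  obtain ⟨K₁, hK₁, h₁⟩ := exists_linear_flux_bound hδ s hs.le
  obtain ⟨K₂, hK₂, h₂⟩ := exists_nonlinear_flux_bound s hs.le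
  have hA := (hw 0).nonneg
  refine ⟨2 * K₁ * A ^ 2 + K₂ * A ^ 3, by positivity, fun R hR T hT => ?_⟩
  have hR0 : 0 < R := by linarith
  obtain ⟨K₃, hK₃, h₃⟩ := h₂ R hR
  choose χ hχ using fun n : ℕ => exists_isCutoff (N := (n : ℝ) + 1) (by positivity)
  have hreal : ∀ t, ((∫ x, u t x ^ 2 * gauss R x : ℝ) : ℂ) =
      ∫ x, (∫ ξ, e (x * ξ) * w t ξ) ^ 2 * (gauss R x : ℂ) := by
    intro t
    rw [← integral_complex_ofReal]
    refine integral_congr_ae ?_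
    filter_upwards [coe_ae_eq_integral_e (hw t) (h t)] with x hx
    rw [← hx]
    push_cast
    rfl
  have hlim : ∀ t, Tendsto (fun n => ∫ x, localized (χ n) (w t) x ^ 2 * (gauss R x : ℂ)) atTop
      (𝓝 ((∫ x, u t x ^ 2 * gauss R x : ℝ) : ℂ)) := fun t => by
    rw [hreal]
    exact tendsto_integral_localized_sq hχ (hw t) hR0
  have hn : ∀ n : ℕ, ‖(∫ x, localized (χ n) (w T) x ^ 2 * (gauss R x : ℂ)) -
      ∫ x, localized (χ n) (w 0) x ^ 2 * (gauss R x : ℂ)‖ ≤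
      ((2 * K₁ * A ^ 2 + K₂ * A ^ 3) / R + K₃ * A ^ 3 * ((n : ℝ) + 1) ^ (-(s - 1 / 2))) * T := by
    intro n
    have hmv := Convex.norm_image_sub_le_of_norm_hasDerivWithin_le
      (f := fun t => ∫ x, localized (χ n) (w t) x ^ 2 * (gauss R x : ℂ)) (s := Set.univ)
      (x := (0 : ℝ)) (y := T)
      (C := (2 * K₁ * A ^ 2 + K₂ * A ^ 3) / R + K₃ * A ^ 3 * ((n : ℝ) + 1) ^ (-(s - 1 / 2)))
      (fun t _ => (hasDerivAt_integral_localized_sq hδ hu hw h (hχ n) hR0 t).hasDerivWithinAt)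
      (fun t _ => by
        rw [integral_localized_mul_localizedRHS hδ (hw t) (hχ n) hR0, norm_mul,
          Complex.norm_ofNat]
        have b1 := h₁ R hR _ A (χ n) (w t) (hχ n) (hw t)
        have b2 := h₃ _ A (χ n) (w t) (by positivity) (hχ n) (hw t)
        refine (mul_le_mul_of_nonneg_left (norm_sub_le _ _) (by norm_num)).trans ?_
        rw [norm_mul, show ‖(1 / 2 : ℂ)‖ = 1 / 2 by norm_num]
        have e1 : (2 * K₁ * A ^ 2 + K₂ * A ^ 3) / R = 2 * (K₁ * A ^ 2 / R) + K₂ * A ^ 3 / R := by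
          ring
        rw [e1]
        linarith)
      convex_univ trivial trivial
    simpa [abs_of_nonneg hT] using hmv
  have hpow : Tendsto (fun n : ℕ => ((n : ℝ) + 1) ^ (-(s - 1 / 2))) atTop (𝓝 0) :=
    (tendsto_rpow_neg_atTop (by linarith)).comp
      (tendsto_atTop_add_const_right _ 1 tendsto_natCast_atTop_atTop)
  have hr : Tendsto (fun n : ℕ => ((2 * K₁ * A ^ 2 + K₂ * A ^ 3) / R +
      K₃ * A ^ 3 * ((n : ℝ) + 1) ^ (-(s - 1 / 2))) * T) atTop
      (𝓝 (((2 * K₁ * A ^ 2 + K₂ * A ^ 3) / R + K₃ * A ^ 3 * 0) * T)) :=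
    (((hpow.const_mul _).const_add _).mul_const _)
  have hfin := le_of_tendsto_of_tendsto' ((hlim T).sub (hlim 0)).norm hr hn
  rw [← Complex.ofReal_sub, Complex.norm_real, Real.norm_eq_abs] at hfin
  refine hfin.trans (le_of_eq ?_)
  ring

theorem integrable_sq_Lp (f : Lp ℝ 2 (volume : Measure ℝ)) : Integrable fun x => f x ^ 2 :=
  (memLp_two_iff_integrable_sq (Lp.memLp f).1).1 (Lp.memLp f)

theorem integrable_sq_mul_gauss (f : Lp ℝ 2 (volume : Measure ℝ)) (R : ℝ) :
    Integrable fun x => f x ^ 2 * gauss R x :=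
  (integrable_sq_Lp f).mul_bdd (c := 1) (continuous_gauss R).aestronglyMeasurable
    (Eventually.of_forall fun x => by
      rw [Real.norm_of_nonneg (gauss_nonneg _ _)]; exact gauss_le_one _ _)

theorem tendsto_integral_sq_mul_gauss (f : Lp ℝ 2 (volume : Measure ℝ)) :
    Tendsto (fun R => ∫ x, f x ^ 2 * gauss R x) atTop (𝓝 (∫ x, f x ^ 2)) := by
  refine tendsto_integral_filter_of_dominated_convergence (fun x => f x ^ 2)
    (Eventually.of_forall fun R => (integrable_sq_mul_gauss f R).aestronglyMeasurable)
    (Eventually.of_forall fun R => Eventually.of_forall fun x => ?_) (integrable_sq_Lp f)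
    (Eventually.of_forall fun x => ?_)
  · rw [Real.norm_of_nonneg (mul_nonneg (sq_nonneg _) (gauss_nonneg _ _))]
    exact mul_le_of_le_one_right (sq_nonneg _) (gauss_le_one _ _)
  · have h1 : Tendsto (fun R : ℝ => x / R) atTop (𝓝 0) := tendsto_const_nhds.div_atTop tendsto_id
    have h2 : Tendsto (fun R : ℝ => gauss R x) atTop (𝓝 (Real.exp (-Real.pi * 0 ^ 2))) :=
      (Real.continuous_exp.tendsto _).comp ((h1.pow 2).const_mul _)
    simpa using h2.const_mul (f x ^ 2)

/-- Letting the window grow, the mass `∫ u²` is conserved. -/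
theorem mass_conservation {K : ℝ} (hK : ∀ R, 1 ≤ R → ∀ T, 0 ≤ T →
      |(∫ x, u T x ^ 2 * gauss R x) - ∫ x, u 0 x ^ 2 * gauss R x| ≤ K * T / R)
    {T : ℝ} (hT : 0 ≤ T) : ∫ x, u T x ^ 2 = ∫ x, u 0 x ^ 2 := by
  have h1 := ((tendsto_integral_sq_mul_gauss (u T)).sub (tendsto_integral_sq_mul_gauss (u 0))).abs
  have h2 : Tendsto (fun R : ℝ => K * T / R) atTop (𝓝 0) := tendsto_const_nhds.div_atTop tendsto_id
  have h3 := le_of_tendsto_of_tendsto h1 h2 (by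
    filter_upwards [eventually_ge_atTop 1] with R hR using hK R hR T hT)
  linarith [abs_nonpos_iff.1 h3]

/-- The mass outside a window of width comparable to `R` is controlled by the complement of the
Gaussian weight. -/
theorem eLpNorm_restrict_le (f : Lp ℝ 2 (volume : Measure ℝ)) {a R : ℝ} (ha : 0 < a) (hR : 0 < R)
    {S : Set ℝ} (hSm : MeasurableSet S) (hS : ∀ x ∈ S, a * R ≤ |x|) :
    eLpNorm f 2 (volume.restrict S) ≤ ENNReal.ofReal (((1 - Real.exp (-Real.pi * a ^ 2))⁻¹ *
      ((∫ x, f x ^ 2) - ∫ x, f x ^ 2 * gauss R x)) ^ (1 / 2 : ℝ)) := by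
  have hpi := Real.pi_pos
  have hpos : 0 < 1 - Real.exp (-Real.pi * a ^ 2) := by
    have : Real.exp (-Real.pi * a ^ 2) < 1 := Real.exp_lt_one_iff.2 (by nlinarith [pow_pos ha 2])
    linarith
  rw [((Lp.memLp f).restrict S).eLpNorm_eq_integral_rpow_norm (by norm_num) (by norm_num)]
  refine ENNReal.ofReal_le_ofReal ?_
  simp only [ENNReal.toReal_ofNat, Real.rpow_two, Real.norm_eq_abs, sq_abs]
  rw [← one_div]
  refine Real.rpow_le_rpow (integral_nonneg fun x => sq_nonneg _) ?_ (by norm_num)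
  have hi : Integrable fun x => f x ^ 2 - f x ^ 2 * gauss R x :=
    (integrable_sq_Lp f).sub (integrable_sq_mul_gauss f R)
  have hnn : ∀ x, 0 ≤ f x ^ 2 - f x ^ 2 * gauss R x := fun x => by
    nlinarith [sq_nonneg (f x), gauss_le_one R x]
  rw [← integral_sub (integrable_sq_Lp f) (integrable_sq_mul_gauss f R), inv_mul_eq_div,
    le_div_iff₀ hpos, ← integral_mul_const]
  refine (setIntegral_mono_on ((integrable_sq_Lp f).mul_const _).integrableOn hi.integrableOn hSm
    fun x hx => ?_).trans (setIntegral_le_integral hi (Eventually.of_forall hnn))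
  have hg : gauss R x ≤ Real.exp (-Real.pi * a ^ 2) := by
    refine Real.exp_le_exp.2 ?_
    have h1 : a ≤ |x / R| := by
      rw [abs_div, abs_of_pos hR, le_div_iff₀ hR]
      exact hS x hx
    have h2 : a ^ 2 ≤ (x / R) ^ 2 := by
      rw [← sq_abs (x / R)]
      gcongr
    nlinarith
  nlinarith [sq_nonneg (f x)]

end

end ILW

theorem theorem1p6 (δ : ℝ) (hδ : 0 < δ) (s : ℝ) (hs : 1 / 2 < s)
    (u : ℝ → Lp ℝ 2 (volume : Measure ℝ))
    (hu : ILW.IsSolution δ u) (hreg : ILW.BoundedContinuousSobolev s u)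
    (ε : ℝ) (hε : 0 < ε) (μ : ℝ → ℝ) (c : ℝ) (hc : 0 < c)
    (hμ : ∀ᶠ t in atTop, c * (t * Real.log t ^ (1 + ε)) ≤ μ t)
    (a b : ℝ) (ha : 0 < a) (hab : a ≤ b) :
    Tendsto (fun t : ℝ => eLpNorm (u t) 2
        (volume.restrict {x : ℝ | a * μ t ≤ |x| ∧ |x| ≤ b * μ t}))
      atTop (𝓝 0) := by
  obtain ⟨v, hv, -, C, hC⟩ := hreg
  obtain ⟨A, hA⟩ := ILW.exists_isProfile hs C
  obtain ⟨K, hK, hKR⟩ := ILW.exists_energy_bound hδ hs hu (fun t => hA (v t) (hC t))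
    (fun t φ => ILW.toDist_fourier_eq (hv t) φ)
  have hlog : Tendsto (fun t : ℝ => Real.log t ^ (1 + ε)) atTop atTop :=
    (tendsto_rpow_atTop (by linarith)).comp Real.tendsto_log_atTop
  have hμtop : Tendsto μ atTop atTop :=
    tendsto_atTop_mono' _ hμ ((tendsto_id.atTop_mul_atTop₀ hlog).const_mul_atTop hc)
  have hratio : Tendsto (fun t => t / μ t) atTop (𝓝 0) := by
    refine squeeze_zero' ?_ ?_ (hlog.const_mul_atTop hc).inv_tendsto_atTop
    · filter_upwards [eventually_gt_atTop 0, hμtop.eventually_gt_atTop 0] with t h1 h2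
      positivity
    · filter_upwards [eventually_gt_atTop 0, hμtop.eventually_gt_atTop 0, hμ,
        hlog.eventually_gt_atTop 0] with t h1 h2 h3 h4
      rw [Pi.inv_apply, inv_eq_one_div, div_le_div_iff₀ h2 (by positivity)]
      linarith
  have hg : Tendsto (fun t => (∫ x, u 0 x ^ 2) - (∫ x, u 0 x ^ 2 * ILW.gauss (μ t) x) +
      K * (t / μ t)) atTop (𝓝 0) := by
    have h1 := ((ILW.tendsto_integral_sq_mul_gauss (u 0)).comp hμtop).const_sub (∫ x, u 0 x ^ 2)
    simpa using h1.add (hratio.const_mul K)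
  have hb : Tendsto (fun t => ENNReal.ofReal (((1 - Real.exp (-Real.pi * a ^ 2))⁻¹ *
      ((∫ x, u 0 x ^ 2) - (∫ x, u 0 x ^ 2 * ILW.gauss (μ t) x) + K * (t / μ t))) ^ (1 / 2 : ℝ)))
      atTop (𝓝 0) := by
    have h1 := (hg.const_mul (1 - Real.exp (-Real.pi * a ^ 2))⁻¹).rpow_const
      (p := (1 / 2 : ℝ)) (Or.inr (by norm_num))
    have h2 := ENNReal.tendsto_ofReal h1
    simpa using h2
  refine tendsto_of_tendsto_of_tendsto_of_le_of_le' tendsto_const_nhds hb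
    (Eventually.of_forall fun t => zero_le) ?_
  filter_upwards [eventually_ge_atTop 0, hμtop.eventually_ge_atTop 1] with t ht hμ1
  have hμ0 : 0 < μ t := by linarith
  have hSm : MeasurableSet {x : ℝ | a * μ t ≤ |x| ∧ |x| ≤ b * μ t} :=
    (measurableSet_le measurable_const continuous_abs.measurable).inter
      (measurableSet_le continuous_abs.measurable measurable_const)
  refine (ILW.eLpNorm_restrict_le (u t) ha hμ0 hSm fun x hx => hx.1).trans ?_
  refine ENNReal.ofReal_le_ofReal ?_
  have hexp : Real.exp (-Real.pi * a ^ 2) ≤ 1 :=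
    Real.exp_le_one_iff.2 (by nlinarith [Real.pi_pos, sq_nonneg a])
  have hinv : 0 ≤ (1 - Real.exp (-Real.pi * a ^ 2))⁻¹ := inv_nonneg.2 (by linarith)
  have hnn : 0 ≤ (∫ x, u t x ^ 2) - ∫ x, u t x ^ 2 * ILW.gauss (μ t) x := by
    rw [sub_nonneg]
    refine integral_mono (ILW.integrable_sq_mul_gauss _ _) (ILW.integrable_sq_Lp _) fun x => ?_
    exact mul_le_of_le_one_right (sq_nonneg _) (ILW.gauss_le_one _ _)
  refine Real.rpow_le_rpow (mul_nonneg hinv hnn) (mul_le_mul_of_nonneg_left ?_ hinv) (by norm_num)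
  have h1 := hKR (μ t) hμ1 t ht
  rw [ILW.mass_conservation hKR ht, ← mul_div_assoc]
  linarith [(abs_le.1 h1).1]
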